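/- Let $\mathscr H$ be a separable complex Hilbert space. For $0<p<\infty$ let $\boldsymbol S_p$ be the Schatten--von Neumann class of bounded operators $T$ on $\mathscr H$ with $\sum_{n\ge0}s_n(T)^p<\infty$, where $s_n(T)=\inf\{\|T-R\|:\operatorname{rank}R\le n\}$, and let $\boldsymbol S_\infty$ be the set of all bounded operators on $\mathscr H$. For spectral measures $E_1,\dots,E_m$ on $\mathscr H$ (defined on measurable spaces $\mathscr X_1,\dots,\mathscr X_m$), the Haagerup tensor product $L^\infty(E_1)\otimes_{\rm h}\cdots\otimes_{\rm h}L^\infty(E_m)$ is the class of functions $\Psi$ of the form $$\Psi(x_1,\dots,x_m)=\sum_{j_1,\dots,j_{m-1}\ge0}\alpha_{j_1}(x_1)\,\beta^{(2)}_{j_1j_2}(x_2)\cdots\beta^{(m-1)}_{j_{m-2}j_{m-1}}(x_{m-1})\,\delta_{j_{m-1}}(x_m)\quad\text{a.e.},$$ where all coefficient functions are measurable, $\{\alpha_j\}\in L^\infty_{E_1}(\ell^2)$, $\{\delta_j\}\in L^\infty_{E_m}(\ell^2)$, and $\{\beta^{(i)}_{jk}\}\in L^\infty_{E_i}(\mathcal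 B)$ for $2\le i\le m-1$, $\mathcal B$ being the space of matrices inducing bounded operators on $\ell^2$ with the operator norm; the sum is the limit of the sums over $0\le j_i\le N_i$ as all $N_i\to\infty$ independently. For such $\Psi$ and bounded operators $T_1,\dots,T_{m-1}$ on $\mathscr H$, the multiple operator integral is $$\int\!\cdots\!\int\Psi\,dE_1T_1\,dE_2T_2\cdots T_{m-1}\,dE_m=\sum_{j_1,\dots,j_{m-1}}A_{j_1}T_1B^{(2)}_{j_1j_2}T_2\cdots B^{(m-1)}_{j_{m-2}j_{m-1}}T_{m-1}D_{j_{m-1}},$$ where $A_j=\int\alpha_j\,dE_1$, $B^{(i)}_{jk}=\int\beta^{(i)}_{jk}\,dE_i$, $D_j=\int\delta_j\,dE_m$, and the sum, understood as above, converges in the weak operator topology. A symmetrically quasinormed ideal $\mathfrak S$ of operators on $\mathscr H$ is a linear subspace of the bounded operators on $\mathscr H$ with a complete quasinorm $\|\cdot\|_{\mathfrak S}$ such that $ATB\in\mathfrak S$ and $\|ATB\|_{\mathfrak S}\le\|A\|\,\|T\|_{\mathfrak S}\|B\|$ for all $T\in\mathfrak S$ and all bounded $A$, $B$. **Theorem.**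 Let $m\ge3$, let $p_1,\dots,p_{m-1}\in(0,\infty]$, and define $r\in[1,\infty]$ by $$\frac1r=\frac1{\max\{p_1,2\}}+\frac1{\max\{p_{m-1},2\}}.$$ Let $\mathfrak S$ be a symmetrically quasinormed ideal of operators on $\mathscr H$. Suppose that $$\int\!\cdots\!\int\Psi(x_1,\dots,x_m)\,dE_1(x_1)T_1\,dE_2(x_2)T_2\cdots T_{m-1}\,dE_m(x_m)\in\mathfrak S$$ whenever $E_1,\dots,E_m$ are spectral measures on $\mathscr H$, $\Psi\in L^\infty(E_1)\otimes_{\rm h}\cdots\otimes_{\rm h}L^\infty(E_m)$, and $T_j\in\boldsymbol S_{p_j}$ for $j=1,\dots,m-1$. Then $\boldsymbol S_r\subset\mathfrak S$. -/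

import Mathlib

open MeasureTheory Filter Topology
open scoped ENNReal NNReal

/-- A spectral measure on the measurable space `X`, acting on the Hilbert space `H`: a strongly
countably additive function on the measurable sets whose values are orthogonal projections, with
`E(X) = I`. (The values on non-measurable sets are irrelevant.) -/
structure SpectralMeasure (X : Type*) [MeasurableSpace X] (H : Type*) [NormedAddCommGroup H]
    [InnerProductSpace ℂ H] [CompleteSpace H] where
  proj : Set X → H →L[ℂ] H
  isStarProjection : ∀ s, MeasurableSet s → IsStarProjection (proj s)
  univ : proj Set.univ = 1
  hasSum_iUnion : ∀ f : ℕ → Set X, (∀ i, MeasurableSet (f i)) →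
    Pairwise (fun i j => Disjoint (f i) (f j)) →
    ∀ x : H, HasSum (fun i => proj (f i) x) (proj (⋃ i, f i) x)

namespace SpectralMeasure

variable {X : Type*} [MeasurableSpace X] {H : Type*} [NormedAddCommGroup H]
  [InnerProductSpace ℂ H] [CompleteSpace H]

theorem proj_empty (E : SpectralMeasure X H) : E.proj ∅ = 0 := by
  ext x
  have h := E.hasSum_iUnion (fun _ => ∅) (fun _ => MeasurableSet.empty)
    (fun _ _ _ => disjoint_bot_left) x
  exact tendsto_nhds_unique tendsto_const_nhds h.summable.tendsto_atTop_zero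

theorem normSq_proj (E : SpectralMeasure X H) {s : Set X} (hs : MeasurableSet s) (x : H) :
    ‖E.proj s x‖ ^ 2 = (inner ℂ x (E.proj s x)).re := by
  have hP := E.isStarProjection s hs
  have h1 : E.proj s (E.proj s x) = E.proj s x :=
    congrArg (fun A : H →L[ℂ] H => A x) hP.isIdempotentElem
  have h2 : inner ℂ (E.proj s x) (E.proj s x) = inner ℂ x (E.proj s (E.proj s x)) :=
    hP.isSelfAdjoint.isSymmetric x (E.proj s x)
  rw [h1] at h2
  rw [← h2, inner_self_eq_norm_sq_to_K]
  norm_cast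

/-- The finite positive measure `Δ ↦ (E(Δ)x, x) = ‖E(Δ)x‖²`. -/
noncomputable def scalarMeasure (E : SpectralMeasure X H) (x : H) : Measure X :=
  Measure.ofMeasurable (fun s _ => ENNReal.ofReal (‖E.proj s x‖ ^ 2))
    (by simp [E.proj_empty])
    (by
      intro f hf hd
      have h := E.hasSum_iUnion f hf hd x
      have h1 : HasSum (fun i => ‖E.proj (f i) x‖ ^ 2) (‖E.proj (⋃ i, f i) x‖ ^ 2) := by
        have h2 := (Complex.reCLM.comp (innerSL ℂ x |>.restrictScalars ℝ)).hasSum h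
        rw [E.normSq_proj (MeasurableSet.iUnion hf)]
        simp_rw [fun i => E.normSq_proj (hf i) x]
        exact h2
      rw [← h1.tsum_eq, ENNReal.ofReal_tsum_of_nonneg (fun _ => sq_nonneg _) h1.summable])

/-- `A = ∫ φ dE`: the operator `A` is determined by its quadratic form
`(Ax, x) = ∫ φ d(E(·)x, x)`. -/
def HasIntegral (E : SpectralMeasure X H) (φ : X → ℂ) (A : H →L[ℂ] H) : Prop :=
  ∀ x : H, Integrable φ (E.scalarMeasure x) ∧
    inner ℂ x (A x) = ∫ t, φ t ∂(E.scalarMeasure x)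

/-- `E`-null measurable sets. -/
def IsNull (E : SpectralMeasure X H) (N : Set X) : Prop :=
  MeasurableSet N ∧ E.proj N = 0

/-- The property `P` holds `E`-almost everywhere. -/
def AE (E : SpectralMeasure X H) (P : X → Prop) : Prop :=
  ∃ N, E.IsNull N ∧ ∀ x, x ∉ N → P x

/-- `{α_j} ∈ L^∞_E(ℓ²)`. -/
def MemLinftyL2 (E : SpectralMeasure X H) (α : ℕ → X → ℂ) : Prop :=
  (∀ j, Measurable (α j)) ∧ ∃ C : ℝ≥0, E.AE fun x => ∑' j, ‖α j x‖ₑ ^ 2 ≤ C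

/-- `{β_{jk}} ∈ L^∞_E(𝓑)`, where `𝓑` is the space of matrices inducing bounded operators on `ℓ²`
with the operator norm. -/
def MemLinftyB (E : SpectralMeasure X H) (β : ℕ → ℕ → X → ℂ) : Prop :=
  (∀ j k, Measurable (β j k)) ∧ ∃ C : ℝ, E.AE fun x =>
    ∃ M : lp (fun _ : ℕ => ℂ) 2 →L[ℂ] lp (fun _ : ℕ => ℂ) 2,
      ‖M‖ ≤ C ∧ ∀ j k, M (lp.single 2 k 1) j = β j k x

end SpectralMeasure

section Haagerup

variable {H : Type*} [NormedAddCommGroup H] [InnerProductSpace ℂ H] [CompleteSpace H]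

/-- Coefficient data for an element of the Haagerup tensor product
`L^∞(E_1) ⊗_h ⋯ ⊗_h L^∞(E_m)`, `m = n + 2`: a sequence for the first variable, matrices for the
`n` intermediate variables, and a sequence for the last variable. -/
structure HaagerupData {n : ℕ} {X : Fin (n + 2) → Type*} [∀ i, MeasurableSpace (X i)]
    (E : ∀ i, SpectralMeasure (X i) H) where
  left : ℕ → X 0 → ℂ
  mid : ∀ i : Fin n, ℕ → ℕ → X i.succ.castSucc → ℂ
  right : ℕ → X (Fin.last (n + 1)) → ℂ
  left_mem : (E 0).MemLinftyL2 left
  mid_mem : ∀ i : Fin n, (E i.succ.castSucc).MemLinftyB (mid i)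
  right_mem : (E (Fin.last (n + 1))).MemLinftyL2 right

/-- The box of multi-indices `j` with `j i < N i`. -/
def indexBox {n : ℕ} (N : Fin (n + 1) → ℕ) : Finset (Fin (n + 1) → ℕ) :=
  Fintype.piFinset fun i => Finset.range (N i)

/-- `Ψ(x_1, …, x_m) = ∑ α_{j_1}(x_1) β_{j_1 j_2}(x_2) ⋯ δ_{j_{m-1}}(x_m)` almost everywhere,
the sum being the limit of the partial sums over boxes whose sides tend to infinity
independently. -/
def HaagerupData.Represents {n : ℕ} {X : Fin (n + 2) → Type*} [∀ i, MeasurableSpace (X i)]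
    {E : ∀ i, SpectralMeasure (X i) H} (R : HaagerupData E) (Ψ : (∀ i, X i) → ℂ) : Prop :=
  ∃ N : ∀ i, Set (X i), (∀ i, (E i).IsNull (N i)) ∧ ∀ x : ∀ i, X i, (∀ i, x i ∉ N i) →
    Tendsto (fun L : Fin (n + 1) → ℕ => ∑ j ∈ indexBox L,
      R.left (j 0) (x 0) *
        (∏ i : Fin n, R.mid i (j i.castSucc) (j i.succ) (x i.succ.castSucc)) *
        R.right (j (Fin.last n)) (x (Fin.last (n + 1)))) atTop (𝓝 (Ψ x))

/-- `Ψ ∈ L^∞(E_1) ⊗_h ⋯ ⊗_h L^∞(E_m)`. -/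
def MemHaagerup {n : ℕ} {X : Fin (n + 2) → Type*} [∀ i, MeasurableSpace (X i)]
    (E : ∀ i, SpectralMeasure (X i) H) (Ψ : (∀ i, X i) → ℂ) : Prop :=
  ∃ R : HaagerupData E, R.Represents Ψ

/-- `W = ∫⋯∫ Ψ dE_1 T_1 dE_2 T_2 ⋯ T_{m-1} dE_m`: for a representation of `Ψ`,
`W = ∑ A_{j_1} T_1 B_{j_1 j_2} T_2 ⋯ T_{m-1} D_{j_{m-1}}`, where `A`, `B`, `D` are the spectral
integrals of the coefficients and the partial sums over boxes converge in the weak operator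
topology. -/
def IsMultipleOperatorIntegral {n : ℕ} {X : Fin (n + 2) → Type*} [∀ i, MeasurableSpace (X i)]
    (E : ∀ i, SpectralMeasure (X i) H) (Ψ : (∀ i, X i) → ℂ) (T : Fin (n + 1) → H →L[ℂ] H)
    (W : H →L[ℂ] H) : Prop :=
  ∃ R : HaagerupData E, R.Represents Ψ ∧
    ∃ (A : ℕ → H →L[ℂ] H) (B : Fin n → ℕ → ℕ → H →L[ℂ] H) (D : ℕ → H →L[ℂ] H),
      (∀ j, (E 0).HasIntegral (R.left j) (A j)) ∧
      (∀ i j k, (E i.succ.castSucc).HasIntegral (R.mid i j k) (B i j k)) ∧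
      (∀ j, (E (Fin.last (n + 1))).HasIntegral (R.right j) (D j)) ∧
      ∀ x y : H, Tendsto (fun L : Fin (n + 1) → ℕ => inner ℂ x
        ((∑ j ∈ indexBox L,
          A (j 0) *
            (List.ofFn fun i : Fin n =>
              T i.castSucc * B i (j i.castSucc) (j i.succ)).prod *
            T (Fin.last n) * D (j (Fin.last n))) y)) atTop (𝓝 (inner ℂ x (W y)))

end Haagerup

section Ideals

/-- The singular values `s_n(T) = inf {‖T - R‖ : rank R ≤ n}`, `n ≥ 0`. -/
noncomputable def singularNumber {H : Type*} [NormedAddCommGroup H] [InnerProductSpace ℂ H]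
    (T : H →L[ℂ] H) (n : ℕ) : ℝ :=
  ⨅ R : {R : H →L[ℂ] H // LinearMap.rank (R : H →ₗ[ℂ] H) ≤ n}, ‖T - R‖

/-- The Schatten--von Neumann class `S_p`, `0 < p ≤ ∞`; `S_∞` consists of all bounded operators. -/
def schattenClass (H : Type*) [NormedAddCommGroup H] [InnerProductSpace ℂ H] (p : ℝ≥0∞) :
    Set (H →L[ℂ] H) :=
  {T | p = ∞ ∨ Summable fun n => singularNumber T n ^ p.toReal}

/-- A symmetrically quasinormed ideal of operators on `H`: a linear subspace of the bounded
operators with a complete quasinorm such that `ATB` is in the ideal and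
`‖ATB‖_𝔖 ≤ ‖A‖ ‖T‖_𝔖 ‖B‖` for `T` in the ideal and all bounded `A`, `B`. -/
structure SymmQuasinormedIdeal (H : Type*) [NormedAddCommGroup H] [InnerProductSpace ℂ H] where
  carrier : Submodule ℂ (H →L[ℂ] H)
  qnorm : carrier → ℝ
  qnorm_nonneg : ∀ T, 0 ≤ qnorm T
  eq_zero_of_qnorm_eq_zero : ∀ T, qnorm T = 0 → T = 0
  qnorm_smul : ∀ (c : ℂ) (T : carrier), qnorm (c • T) = ‖c‖ * qnorm T
  qnorm_add_le : ∃ K : ℝ, ∀ S T : carrier, qnorm (S + T) ≤ K * (qnorm S + qnorm T)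
  mul_mem : ∀ (A B : H →L[ℂ] H) (T : carrier), A * (T : H →L[ℂ] H) * B ∈ carrier
  qnorm_mul_le : ∀ (A B : H →L[ℂ] H) (T : carrier),
    qnorm ⟨A * (T : H →L[ℂ] H) * B, mul_mem A B T⟩ ≤ ‖A‖ * qnorm T * ‖B‖
  complete : ∀ u : ℕ → carrier,
    (∀ ε > 0, ∃ N, ∀ k ≥ N, ∀ l ≥ N, qnorm (u k - u l) < ε) →
    ∃ T : carrier, ∀ ε > 0, ∃ N, ∀ k ≥ N, qnorm (u k - T) < ε

end Ideals

/-! In the main case, `H` infinite-dimensional and `r < ∞`, an operator `T` of `S_r` is compact. An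
eigenbasis `b` of `T* T` is sent by `T` to pairwise orthogonal vectors, so `T = U W` with `U`
bounded and `W` diagonal in `b` with entries `s_k = ‖T b_k‖`. These are summable to the power `r`.
As `𝔖` is an ideal, it suffices to realise `W` as a multiple operator integral.

Write `s_k = u_k v_k` with `u = s^{r/P}` in `ℓ^P` and `v = s^{r/Q}` in `ℓ^Q`, where `P` and `Q` are
the maxima of `p_1` and `p_{m-1}` with `2`. The outer spectral measures are diagonal in `b`, and
`α_j = δ_j` is the indicator of the point `j`, so `A_j = D_j` is the projection onto `b_j`. The
matrices `β` are diagonal in `j, k`, so the `j`-th summand may use its own functions bounded by one.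
The intermediate spectral measures come from `L²` of the circle with the Fourier basis identified
with `b`: multiplication by a character carries any chosen basis vector to any other
(`SpectralMeasure.exists_shift`). The `j`-th summand then becomes `u_j v_j` times the projection
onto `b_j`.

The exponent `2` appears because a rank one operator, which lies in every `S_p`, has any `ℓ²`
sequence as matrix entries in one row or column. Shifting by a character makes this whole row or
column available to the diagonal sum. For `p ≥ 2` a diagonal operator is used instead
(`HilbertBasis.exists_schatten_inner_eq`, `HilbertBasis.exists_schatten_apply_eq`). These pieces are
assembled in `HilbertBasis.exists_isMultipleOperatorIntegral_diagonal`. If `r = ∞` or `H` is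
finite-dimensional, the identity itself is such an integral. -/

/-! ### Orthogonal families and operators defined on a Hilbert basis -/

section OrthogonalFamilies

variable {ι H : Type*} [NormedAddCommGroup H] [InnerProductSpace ℂ H]

theorem norm_sq_sum_smul_of_pairwise_inner_eq_zero {w : ι → H}
    (hw : Pairwise fun i j => inner ℂ (w i) (w j) = 0) (c : ι → ℂ) (s : Finset ι) :
    ‖∑ i ∈ s, c i • w i‖ ^ 2 = ∑ i ∈ s, ‖c i‖ ^ 2 * ‖w i‖ ^ 2 := by
  classical
  induction s using Finset.induction_on with
  | empty => simp
  | insert a s ha ih =>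
    rw [Finset.sum_insert ha, Finset.sum_insert ha, ← ih, ← mul_pow, ← norm_smul]
    have h : inner ℂ (c a • w a) (∑ i ∈ s, c i • w i) = 0 := by
      rw [inner_sum]
      refine Finset.sum_eq_zero fun i hi => ?_
      have hne : a ≠ i := fun h => ha (h ▸ hi)
      rw [inner_smul_left, inner_smul_right, hw hne]
      simp
    simpa only [sq] using norm_add_sq_eq_norm_sq_add_norm_sq_of_inner_eq_zero _ _ h

theorem summable_smul_of_pairwise_inner_eq_zero [CompleteSpace H] {w : ι → H}
    (hw : Pairwise fun i j => inner ℂ (w i) (w j) = 0) {c : ι → ℂ}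
    (hc : Summable fun i => ‖c i‖ ^ 2 * ‖w i‖ ^ 2) : Summable fun i => c i • w i := by
  rw [summable_iff_vanishing_norm] at hc ⊢
  intro ε hε
  obtain ⟨s, hs⟩ := hc (ε ^ 2) (by positivity)
  refine ⟨s, fun t ht => ?_⟩
  have h := hs t ht
  rw [← norm_sq_sum_smul_of_pairwise_inner_eq_zero hw, Real.norm_of_nonneg (by positivity)] at h
  exact lt_of_pow_lt_pow_left₀ 2 hε.le h

namespace HilbertBasis

variable (b : HilbertBasis ι ℂ H)

theorem hasSum_norm_sq (x : H) : HasSum (fun i => ‖inner ℂ (b i) x‖ ^ 2) (‖x‖ ^ 2) := by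
  have h := b.hasSum_inner_mul_inner x x
  rw [inner_self_eq_norm_sq_to_K] at h
  have h2 := Complex.hasSum_re h
  convert h2 using 1
  · funext i
    rw [← inner_conj_symm x (b i), ← Complex.normSq_eq_conj_mul_self, Complex.ofReal_re,
      Complex.normSq_eq_norm_sq]
  · norm_cast

theorem clm_ext {S T : H →L[ℂ] H} (h : ∀ i, S (b i) = T (b i)) : S = T := by
  refine ContinuousLinearMap.ext_on (s := Set.range b) ?_ ?_
  · rw [dense_iff_closure_eq, ← Submodule.topologicalClosure_coe, b.dense_span]
    rfl
  · rintro _ ⟨i, rfl⟩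
    exact h i

/-- A bounded family of pairwise orthogonal vectors is the image of a Hilbert basis under a bounded
operator. -/
theorem exists_clm_apply_eq [CompleteSpace H] {w : ι → H} (hw : Pairwise fun i j => inner ℂ (w i) (w j) = 0)
    {C : ℝ} (hC0 : 0 ≤ C) (hC : ∀ i, ‖w i‖ ≤ C) :
    ∃ T : H →L[ℂ] H, ‖T‖ ≤ C ∧ ∀ i, T (b i) = w i := by
  classical
  have hb : ∀ x i, ‖inner ℂ (b i) x‖ ^ 2 * ‖w i‖ ^ 2 ≤ ‖inner ℂ (b i) x‖ ^ 2 * C ^ 2 := by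
    intro x i
    have := hC i
    gcongr
  have hs : ∀ x, Summable fun i => inner ℂ (b i) x • w i := fun x =>
    summable_smul_of_pairwise_inner_eq_zero hw <|
      Summable.of_nonneg_of_le (fun _ => by positivity) (hb x)
        ((b.hasSum_norm_sq x).summable.mul_right _)
  let L : H →ₗ[ℂ] H :=
    { toFun := fun x => ∑' i, inner ℂ (b i) x • w i
      map_add' := fun x y => by
        simp_rw [inner_add_right, add_smul]
        exact (hs x).tsum_add (hs y)
      map_smul' := fun c x => by
        simp_rw [inner_smul_right, mul_smul]
        exact (hs x).tsum_const_smul c }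
  have hL : ∀ x, ‖L x‖ ≤ C * ‖x‖ := by
    intro x
    have ht : Tendsto (fun s : Finset ι => ‖∑ i ∈ s, inner ℂ (b i) x • w i‖ ^ 2) atTop
        (𝓝 (‖L x‖ ^ 2)) := ((hs x).hasSum.norm).pow 2
    have h2 : ‖L x‖ ^ 2 ≤ ‖x‖ ^ 2 * C ^ 2 := by
      refine le_of_tendsto ht (Eventually.of_forall fun s => ?_)
      rw [norm_sq_sum_smul_of_pairwise_inner_eq_zero hw]
      refine (Finset.sum_le_sum fun i _ => hb x i).trans ?_
      rw [← Finset.sum_mul]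
      gcongr
      exact sum_le_hasSum s (fun _ _ => by positivity) (b.hasSum_norm_sq x)
    rw [← mul_pow, mul_comm] at h2
    exact le_of_sq_le_sq h2 (by positivity)
  refine ⟨L.mkContinuous C hL, L.mkContinuous_norm_le hC0 hL, fun i => ?_⟩
  change ∑' j, inner ℂ (b j) (b i) • w j = w i
  rw [tsum_eq_single i]
  · simp [b.orthonormal.norm_eq_one]
  · intro j hj
    rw [b.orthonormal.inner_eq_zero hj, zero_smul]

theorem exists_diagonal [CompleteSpace H] (u : ι → ℂ) {C : ℝ} (hC0 : 0 ≤ C) (hC : ∀ i, ‖u i‖ ≤ C) :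
    ∃ T : H →L[ℂ] H, ‖T‖ ≤ C ∧ ∀ i, T (b i) = u i • b i := by
  refine b.exists_clm_apply_eq (fun i j hij => ?_) hC0 (fun i => ?_)
  · simp [b.orthonormal.inner_eq_zero hij]
  · rw [norm_smul, b.orthonormal.norm_eq_one, mul_one]
    exact hC i

theorem inner_diagonal {u : ι → ℂ} {T : H →L[ℂ] H} (hT : ∀ i, T (b i) = u i • b i) (i : ι)
    (x : H) : inner ℂ (b i) (T x) = u i * inner ℂ (b i) x := by
  classical
  have h : (innerSL ℂ (b i)).comp T = u i • innerSL ℂ (b i) := by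
    refine ContinuousLinearMap.ext_on (s := Set.range b) ?_ ?_
    · rw [dense_iff_closure_eq, ← Submodule.topologicalClosure_coe, b.dense_span]
      rfl
    · rintro _ ⟨j, rfl⟩
      simp only [ContinuousLinearMap.comp_apply, hT, map_smul, smul_apply,
        innerSL_apply_apply, smul_eq_mul]
      by_cases hij : i = j
      · rw [hij]
      · rw [b.orthonormal.inner_eq_zero hij]
        simp
  exact congrArg (fun f => f x) h

/-- The Hilbert basis indexed by an equivalent type. -/
theorem exists_reindex [CompleteSpace H] {κ : Type*} (e : κ ≃ ι) :
    ∃ b' : HilbertBasis κ ℂ H, ∀ k, b' k = b (e k) := by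
  have ho : Orthonormal ℂ (fun k => b (e k)) := b.orthonormal.comp e e.injective
  have hr : Set.range (fun k => b (e k)) = Set.range b := e.surjective.range_comp b
  refine ⟨HilbertBasis.mk ho ?_, fun k => ?_⟩
  · rw [hr, b.dense_span]
  · simp

end HilbertBasis

end OrthogonalFamilies

/-! ### Singular numbers and Schatten classes -/

section SingularNumbers

variable {ι H : Type*} [NormedAddCommGroup H] [InnerProductSpace ℂ H]

theorem singularNumber_nonneg (T : H →L[ℂ] H) (n : ℕ) : 0 ≤ singularNumber T n :=
  Real.iInf_nonneg fun _ => norm_nonneg _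

theorem singularNumber_le (T : H →L[ℂ] H) {n : ℕ} (R : H →L[ℂ] H)
    (hR : LinearMap.rank (R : H →ₗ[ℂ] H) ≤ n) : singularNumber T n ≤ ‖T - R‖ :=
  ciInf_le (f := fun R : {R : H →L[ℂ] H // LinearMap.rank (R : H →ₗ[ℂ] H) ≤ n} => ‖T - R‖)
    ⟨0, by rintro _ ⟨R, rfl⟩; exact norm_nonneg _⟩ ⟨R, hR⟩

theorem nonempty_rank_le (n : ℕ) :
    Nonempty {R : H →L[ℂ] H // LinearMap.rank (R : H →ₗ[ℂ] H) ≤ n} :=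
  ⟨⟨0, by simp⟩⟩

theorem le_singularNumber (T : H →L[ℂ] H) {n : ℕ} {c : ℝ}
    (h : ∀ R : H →L[ℂ] H, LinearMap.rank (R : H →ₗ[ℂ] H) ≤ n → c ≤ ‖T - R‖) :
    c ≤ singularNumber T n :=
  haveI := nonempty_rank_le (H := H) n
  le_ciInf fun R => h R R.2

theorem exists_norm_sub_lt_of_singularNumber_lt (T : H →L[ℂ] H) {n : ℕ} {c : ℝ}
    (h : singularNumber T n < c) :
    ∃ R : H →L[ℂ] H, LinearMap.rank (R : H →ₗ[ℂ] H) ≤ n ∧ ‖T - R‖ < c := by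
  have := nonempty_rank_le (H := H) n
  obtain ⟨R, hR⟩ := exists_lt_of_ciInf_lt h
  exact ⟨R, R.2, hR⟩

theorem mem_schattenClass_of_rank_le {T : H →L[ℂ] H} {N : ℕ}
    (hT : LinearMap.rank (T : H →ₗ[ℂ] H) ≤ N) {p : ℝ≥0∞} (hp : 0 < p) :
    T ∈ schattenClass H p := by
  rcases eq_or_ne p ∞ with h | h
  · exact Or.inl h
  refine Or.inr (summable_of_ne_finset_zero (s := Finset.range N) fun n hn => ?_)
  have hn' : N ≤ n := by simpa using hn
  have h0 : singularNumber T n = 0 := by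
    refine le_antisymm ?_ (singularNumber_nonneg T n)
    simpa using singularNumber_le T T (hT.trans (by exact_mod_cast hn'))
  rw [h0, Real.zero_rpow (ENNReal.toReal_pos hp.ne' h).ne']

theorem rank_le_one_of_forall_mem_span {T : H →L[ℂ] H} {w : H}
    (h : ∀ x, T x ∈ Submodule.span ℂ {w}) : LinearMap.rank (T : H →ₗ[ℂ] H) ≤ (1 : ℕ) := by
  have hle : LinearMap.range (T : H →ₗ[ℂ] H) ≤ Submodule.span ℂ {w} := by
    rintro _ ⟨x, rfl⟩
    exact h x
  refine (Submodule.rank_mono hle).trans ((rank_span_le _).trans ?_)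
  simp

theorem isCompactOperator_of_rank_le {T : H →L[ℂ] H} {N : ℕ}
    (hT : LinearMap.rank (T : H →ₗ[ℂ] H) ≤ N) : IsCompactOperator T := by
  have hfin : FiniteDimensional ℂ (LinearMap.range (T : H →ₗ[ℂ] H)) :=
    Module.rank_lt_aleph0_iff.mp (hT.trans_lt Cardinal.natCast_lt_aleph0)
  have hid := isCompactOperator_id (E := LinearMap.range (T : H →ₗ[ℂ] H))
  have h2 := (hid.comp_clm (T.codRestrict (LinearMap.range (T : H →ₗ[ℂ] H))
    fun x => ⟨x, rfl⟩)).clm_comp (LinearMap.range (T : H →ₗ[ℂ] H)).subtypeL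
  exact h2

/-- Such an operator is a norm limit of finite rank operators, and the compact operators are norm
closed. -/
theorem isCompactOperator_of_tendsto_singularNumber [CompleteSpace H] {T : H →L[ℂ] H}
    (hT : Tendsto (singularNumber T) atTop (𝓝 0)) : IsCompactOperator T := by
  have hcl := isClosed_setOfPred_isCompactOperator (σ₁₂ := RingHom.id ℂ) (M₁ := H) (M₂ := H)
  have : T ∈ closure {f : H →L[ℂ] H | IsCompactOperator f} := by
    rw [Metric.mem_closure_iff]
    intro ε hε
    obtain ⟨n, hn⟩ := (hT.eventually (gt_mem_nhds hε)).exists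
    obtain ⟨R, hR, hlt⟩ := exists_norm_sub_lt_of_singularNumber_lt T hn
    exact ⟨R, isCompactOperator_of_rank_le hR, by rwa [dist_eq_norm]⟩
  rwa [hcl.closure_eq] at this

theorem tendsto_singularNumber_of_summable {T : H →L[ℂ] H} {q : ℝ} (hq : 0 < q)
    (hT : Summable fun n => singularNumber T n ^ q) : Tendsto (singularNumber T) atTop (𝓝 0) := by
  have h := (hT.tendsto_atTop_zero).rpow_const (p := q⁻¹) (Or.inr (by positivity))
  rw [Real.zero_rpow (by positivity)] at h
  refine h.congr fun n => ?_
  rw [← Real.rpow_mul (singularNumber_nonneg T n), mul_inv_cancel₀ hq.ne', Real.rpow_one]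

namespace HilbertBasis

variable (b : HilbertBasis ι ℂ H) {T : H →L[ℂ] H}

/-- An operator `R` of rank at most `n` kills a unit vector in the span of more than `n` basis
vectors. By orthogonality of the images, `T`, and hence `T - R`, has norm at least `c` on that
vector. -/
theorem le_singularNumber_of_forall_le
    (hT : Pairwise fun i j => inner ℂ (T (b i)) (T (b j)) = 0) {n : ℕ} {F : Finset ι}
    (hF : n < F.card) {c : ℝ} (hc0 : 0 ≤ c) (hc : ∀ i ∈ F, c ≤ ‖T (b i)‖) :
    c ≤ singularNumber T n := by
  refine le_singularNumber T fun R hR => ?_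
  have hdep : ¬ LinearIndependent ℂ (fun i : F => R (b i)) := by
    intro hli
    have hli' : LinearIndependent ℂ
        (fun i : F => (⟨R (b i), ⟨b i, rfl⟩⟩ : LinearMap.range (R : H →ₗ[ℂ] H))) :=
      LinearIndependent.of_comp (LinearMap.range (R : H →ₗ[ℂ] H)).subtype hli
    have h1 := hli'.cardinal_lift_le_rank
    have h2 : Module.rank ℂ (LinearMap.range (R : H →ₗ[ℂ] H)) ≤ (n : Cardinal) := hR
    have h3 := h1.trans (Cardinal.lift_le.mpr h2)
    simp only [Cardinal.mk_coe_finset, Cardinal.lift_natCast, Nat.cast_le] at h3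
    omega
  rw [Fintype.not_linearIndependent_iff] at hdep
  obtain ⟨g, hg, i₀, hi₀⟩ := hdep
  set x : H := ∑ i : F, g i • b i with hx
  have hRx : R x = 0 := by simpa [hx, map_sum] using hg
  have hxn : ‖x‖ ^ 2 = ∑ i : F, ‖g i‖ ^ 2 := by
    rw [hx, norm_sq_sum_smul_of_pairwise_inner_eq_zero (w := fun i : F => b i)
      (fun i j hij => b.orthonormal.inner_eq_zero (fun h => hij (Subtype.ext h)))]
    simp [b.orthonormal.norm_eq_one]
  have hTx : c ^ 2 * ‖x‖ ^ 2 ≤ ‖T x‖ ^ 2 := by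
    have : T x = ∑ i : F, g i • T (b i) := by simp [hx, map_sum]
    rw [this, norm_sq_sum_smul_of_pairwise_inner_eq_zero (w := fun i : F => T (b i))
      (fun i j hij => hT (fun h => hij (Subtype.ext h))), hxn, Finset.mul_sum]
    refine Finset.sum_le_sum fun i _ => ?_
    rw [mul_comm]
    have := hc i i.2
    gcongr
  have hxpos : 0 < ‖x‖ := by
    have : 0 < ‖x‖ ^ 2 := by
      rw [hxn]
      exact Finset.sum_pos' (fun _ _ => by positivity) ⟨i₀, Finset.mem_univ _, by positivity⟩
    exact (sq_pos_iff.mp this).symm.lt_of_le (norm_nonneg _)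
  have h1 : c * ‖x‖ ≤ ‖T x‖ := by
    rw [← mul_pow] at hTx
    exact le_of_sq_le_sq hTx (norm_nonneg _)
  have h2 : ‖T x‖ ≤ ‖T - R‖ * ‖x‖ := by
    have := (T - R).le_opNorm x
    rwa [sub_apply, hRx, sub_zero] at this
  exact le_of_mul_le_mul_right (h1.trans h2) hxpos

/-- Every finite sum is bounded by induction on its size: removing from `n + 1` indices the one with
the smallest `‖T (b i)‖` costs at most `s_n(T)^q`. -/
theorem summable_norm_rpow_of_summable_singularNumber
    (hT : Pairwise fun i j => inner ℂ (T (b i)) (T (b j)) = 0) {q : ℝ} (hq : 0 ≤ q)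
    (hs : Summable fun n => singularNumber T n ^ q) : Summable fun i => ‖T (b i)‖ ^ q := by
  classical
  have key : ∀ (n : ℕ) (F : Finset ι), F.card = n →
      ∑ i ∈ F, ‖T (b i)‖ ^ q ≤ ∑ k ∈ Finset.range n, singularNumber T k ^ q := by
    intro n
    induction n with
    | zero =>
      intro F hF
      rw [Finset.card_eq_zero.mp hF]
      simp
    | succ n ih =>
      intro F hF
      have hne : F.Nonempty := Finset.card_pos.mp (by omega)
      obtain ⟨a, ha, hmin⟩ := F.exists_min_image (fun i => ‖T (b i)‖) hne
      have h1 := ih (F.erase a) (by rw [Finset.card_erase_of_mem ha, hF]; rfl)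
      have h2 := b.le_singularNumber_of_forall_le hT (n := n) (F := F) (by omega)
        (norm_nonneg _) hmin
      rw [← Finset.add_sum_erase F _ ha, Finset.sum_range_succ, add_comm]
      gcongr
  refine summable_of_sum_le (c := ∑' k, singularNumber T k ^ q) (fun i => by positivity)
    fun F => (key _ F rfl).trans (hs.sum_le_tsum _ fun k _ => ?_)
  exact Real.rpow_nonneg (singularNumber_nonneg T k) q

end HilbertBasis

/-- A nonnegative family on an infinite type that tends to zero can be dominated along an injective
sequence: each value off the first `n` chosen indices is at most the `n`-th chosen value. -/
theorem exists_injective_forall_le [Infinite ι] {f : ι → ℝ} (hf0 : ∀ i, 0 ≤ f i)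
    (hf : Tendsto f cofinite (𝓝 0)) :
    ∃ a : ℕ → ι, Function.Injective a ∧
      ∀ n, ∀ i, (∀ k < n, i ≠ a k) → f i ≤ f (a n) := by
  classical
  -- A maximum exists off `F`: a positive value is exceeded only finitely often, and if no value is
  -- positive any index will do.
  have hmax : ∀ F : Finset ι, ∃ a, a ∉ F ∧ ∀ i, i ∉ F → f i ≤ f a := by
    intro F
    by_cases h : ∃ i₀, i₀ ∉ F ∧ 0 < f i₀
    · obtain ⟨i₀, hi₀, hpos⟩ := h
      have hfin : {i | ¬ f i < f i₀}.Finite := hf.eventually (gt_mem_nhds hpos)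
      obtain ⟨a, ha, hamax⟩ := (hfin.toFinset \ F).exists_max_image f ⟨i₀, by simp [hi₀]⟩
      simp only [Finset.mem_sdiff, Set.Finite.mem_toFinset, Set.mem_ofPred_eq, not_lt] at ha hamax
      refine ⟨a, ha.2, fun i hi => ?_⟩
      by_cases hle : f i₀ ≤ f i
      · exact hamax i ⟨hle, hi⟩
      · exact (not_le.mp hle).le.trans ha.1
    · push Not at h
      obtain ⟨a, ha⟩ := Infinite.exists_notMem_finset F
      exact ⟨a, ha, fun i hi => (h i hi).trans (hf0 a)⟩
  choose g hgF hg using hmax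
  -- `A n` is the set of the first `n` indices chosen greedily.
  let A : ℕ → Finset ι := fun n => Nat.rec ∅ (fun _ F => insert (g F) F) n
  have hA : ∀ n i, i ∈ A n ↔ ∃ k < n, i = g (A k) := by
    intro n
    induction n with
    | zero => intro i; simp [A]
    | succ n ih =>
      intro i
      change i ∈ insert (g (A n)) (A n) ↔ _
      rw [Finset.mem_insert, ih]
      constructor
      · rintro (h | ⟨k, hk, h⟩)
        · exact ⟨n, by omega, h⟩
        · exact ⟨k, by omega, h⟩
      · rintro ⟨k, hk, h⟩
        rcases Nat.lt_succ_iff_lt_or_eq.mp hk with h' | rfl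
        · exact Or.inr ⟨k, h', h⟩
        · exact Or.inl h
  refine ⟨fun n => g (A n), ?_, fun n i hi => hg _ i fun hmem => ?_⟩
  · have hlt : ∀ m n, m < n → g (A m) ≠ g (A n) := fun m n hmn h =>
      hgF (A n) ((hA n _).mpr ⟨m, hmn, h.symm⟩)
    intro m n hmn
    rcases lt_trichotomy m n with h | h | h
    · exact absurd hmn (hlt m n h)
    · exact h
    · exact absurd hmn.symm (hlt n m h)
  · obtain ⟨k, hk, h⟩ := (hA n i).mp hmem
    exact hi k hk h

/-- Deleting the `n` largest entries is a perturbation of rank at most `n`, so `s_n(T)` is at most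
the next largest entry `‖u (a n)‖`. -/
theorem HilbertBasis.mem_schattenClass_of_diagonal [CompleteSpace H] [Infinite ι]
    (b : HilbertBasis ι ℂ H) {T : H →L[ℂ] H} {u : ι → ℂ} (hT : ∀ i, T (b i) = u i • b i)
    {p : ℝ≥0∞} (hp : 0 < p) (hu : p ≠ ∞ → Summable fun i => ‖u i‖ ^ p.toReal) :
    T ∈ schattenClass H p := by
  classical
  rcases eq_or_ne p ∞ with hinf | hinf
  · exact Or.inl hinf
  refine Or.inr ?_
  have hq : 0 < p.toReal := ENNReal.toReal_pos hp.ne' hinf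
  have hsum := hu hinf
  have hlim : Tendsto (fun i => ‖u i‖) cofinite (𝓝 0) := by
    have h := (hsum.tendsto_cofinite_zero).rpow_const (p := p.toReal⁻¹) (Or.inr (by positivity))
    rw [Real.zero_rpow (by positivity)] at h
    refine h.congr fun n => ?_
    rw [← Real.rpow_mul (norm_nonneg _), mul_inv_cancel₀ hq.ne', Real.rpow_one]
  obtain ⟨a, hinj, ha⟩ := exists_injective_forall_le (fun i => norm_nonneg (u i)) hlim
  refine Summable.of_nonneg_of_le (fun n => Real.rpow_nonneg (singularNumber_nonneg T n) _)
    (fun n => ?_) (hsum.comp_injective hinj)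
  refine Real.rpow_le_rpow (singularNumber_nonneg T n) ?_ hq.le
  let F : Finset ι := (Finset.range n).image a
  have hF : ∀ i, i ∉ F ↔ ∀ k < n, i ≠ a k := by
    intro i
    simp only [F, Finset.mem_image, Finset.mem_range, not_exists, not_and]
    exact ⟨fun h k hk h' => h k hk h'.symm, fun h k hk h' => h k hk h'.symm⟩
  obtain ⟨D, hDn, hD⟩ := b.exists_diagonal (fun i => if i ∈ F then 0 else u i)
    (norm_nonneg (u (a n))) (fun i => by
      split_ifs with h
      · simp
      · exact ha n i ((hF i).mp h))
  have hrank : LinearMap.rank ((T - D : H →L[ℂ] H) : H →ₗ[ℂ] H) ≤ n := by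
    have hle : LinearMap.range ((T - D : H →L[ℂ] H) : H →ₗ[ℂ] H) ≤
        Submodule.span ℂ (F.image b : Set H) := by
      rintro _ ⟨x, rfl⟩
      have h := (b.hasSum_repr x).mapL (T - D)
      have h0 : ∀ i, i ∉ F → (T - D) (b.repr x i • b i) = 0 := by
        intro i hi
        simp [hT, hD, hi]
      have h1 := (hasSum_sum_of_ne_finset_zero fun i hi => h0 i hi).unique h
      change (T - D) x ∈ _
      rw [← h1]
      refine Submodule.sum_mem _ fun i hi => ?_
      simp only [map_smul, sub_apply, hT, hD, hi, if_true, zero_smul, sub_zero]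
      exact Submodule.smul_mem _ _ (Submodule.smul_mem _ _ (Submodule.subset_span (by
        simpa using ⟨i, hi, rfl⟩)))
    refine (Submodule.rank_mono hle).trans ((rank_span_finset_le _).trans ?_)
    refine Nat.cast_le.mpr (Finset.card_image_le.trans (Finset.card_image_le.trans ?_))
    simp
  have := singularNumber_le T _ hrank
  rw [sub_sub_cancel] at this
  exact this.trans hDn

end SingularNumbers

/-! ### Schmidt decomposition of compact operators -/

section Schmidt

variable {ι H : Type*} [NormedAddCommGroup H] [InnerProductSpace ℂ H]

/-- Orthonormal vectors lie at distance `√2`, so the balls of radius `1/2` around them are disjoint.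
-/
theorem Orthonormal.countable_index [TopologicalSpace.SeparableSpace H] {v : ι → H}
    (hv : Orthonormal ℂ v) : Countable ι := by
  refine Pairwise.countable_of_isOpen_disjoint (s := fun i => Metric.ball (v i) (1 / 2))
    (fun i j hij => ?_) (fun _ => Metric.isOpen_ball)
    (fun i => ⟨v i, Metric.mem_ball_self (by norm_num)⟩)
  refine Metric.ball_disjoint_ball ?_
  have h2 : ‖v i - v j‖ ^ 2 = 2 := by
    rw [@norm_sub_sq ℂ, hv.inner_eq_zero hij, hv.norm_eq_one, hv.norm_eq_one]
    norm_num
  rw [dist_eq_norm]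
  nlinarith [norm_nonneg (v i - v j)]

variable [CompleteSpace H]

theorem exists_hilbertBasis_nat_of_hilbertBasis [TopologicalSpace.SeparableSpace H]
    (hH : ¬ FiniteDimensional ℂ H) (b : HilbertBasis ι ℂ H) :
    ∃ (e : ℕ ≃ ι) (b' : HilbertBasis ℕ ℂ H), ∀ k, b' k = b (e k) := by
  have hc := b.orthonormal.countable_index
  have hi : Infinite ι := by
    by_contra hfin
    rw [not_infinite_iff_finite] at hfin
    have := Fintype.ofFinite ι
    exact hH (b.toOrthonormalBasis.toBasis.finiteDimensional_of_finite)
  obtain ⟨e⟩ := nonempty_equiv_of_countable (α := ℕ) (β := ι)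
  exact ⟨e, b.exists_reindex e⟩

theorem exists_hilbertBasis_nat [TopologicalSpace.SeparableSpace H]
    (hH : ¬ FiniteDimensional ℂ H) : Nonempty (HilbertBasis ℕ ℂ H) := by
  obtain ⟨w, b, -⟩ := exists_hilbertBasis ℂ H
  obtain ⟨-, b', -⟩ := exists_hilbertBasis_nat_of_hilbertBasis hH b
  exact ⟨b'⟩

open Module.End in
-- Bases of all eigenspaces, the kernel included, are glued together; by the spectral theorem
-- nothing is orthogonal to all eigenspaces.
theorem exists_hilbertBasis_eigenvectors [TopologicalSpace.SeparableSpace H]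
    (hH : ¬ FiniteDimensional ℂ H) {K : H →L[ℂ] H} (hK : IsCompactOperator K)
    (hs : (K : H →ₗ[ℂ] H).IsSymmetric) :
    ∃ (b : HilbertBasis ℕ ℂ H) (μ : ℕ → ℂ), ∀ i, K (b i) = μ i • b i := by
  have hcompl : ∀ μ : ℂ, CompleteSpace (eigenspace (K : Module.End ℂ H) μ) := by
    intro μ
    have : IsClosed (eigenspace (K : Module.End ℂ H) μ : Set H) := by
      have : (eigenspace (K : Module.End ℂ H) μ : Set H) = {x | K x = μ • x} := by
        ext x
        exact mem_eigenspace_iff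
      rw [this]
      exact isClosed_eq K.continuous (continuous_const_smul μ)
    exact this.completeSpace_coe
  have hex := fun μ : ℂ => exists_hilbertBasis ℂ (eigenspace (K : Module.End ℂ H) μ)
  choose w B hB using hex
  have ho := hs.orthogonalFamily_eigenspaces.orthonormal_sigma_orthonormal
    (fun μ => (B μ).orthonormal)
  have hbot : (Submodule.span ℂ (Set.range fun a : Σ μ, w μ =>
      (eigenspace (K : Module.End ℂ H) a.1).subtypeₗᵢ (B a.1 a.2)))ᗮ = ⊥ := by
    rw [eq_bot_iff, ← ContinuousLinearMap.orthogonalComplement_iSup_eigenspaces_eq_bot hK hs]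
    intro x hx
    rw [← Submodule.iInf_orthogonal, Submodule.mem_iInf]
    refine fun μ => (Submodule.mem_orthogonal' _ _).mpr fun v hv => ?_
    have h1 := ((B μ).hasSum_repr ⟨v, hv⟩).mapL
      ((innerSL ℂ x).comp (eigenspace (K : Module.End ℂ H) μ).subtypeL)
    have h0 : ∀ i, ((innerSL ℂ x).comp (eigenspace (K : Module.End ℂ H) μ).subtypeL)
        ((B μ).repr ⟨v, hv⟩ i • B μ i) = 0 := by
      intro i
      have h2 : inner ℂ x ((B μ i : eigenspace (K : Module.End ℂ H) μ) : H) = 0 :=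
        (Submodule.mem_orthogonal' _ _).mp hx _ (Submodule.subset_span ⟨⟨μ, i⟩, rfl⟩)
      simp [h2]
    simp_rw [h0] at h1
    exact h1.unique hasSum_zero
  obtain ⟨e, b, hb⟩ := exists_hilbertBasis_nat_of_hilbertBasis hH
    (HilbertBasis.mkOfOrthogonalEqBot ho hbot)
  refine ⟨b, fun i => (e i).1, fun i => ?_⟩
  rw [hb, HilbertBasis.coe_mkOfOrthogonalEqBot]
  exact mem_eigenspace_iff.mp (B (e i).1 (e i).2).2

/-- A compact operator maps some Hilbert basis to a family of pairwise orthogonal vectors. -/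
theorem exists_hilbertBasis_pairwise_inner_eq_zero [TopologicalSpace.SeparableSpace H]
    (hH : ¬ FiniteDimensional ℂ H) {T : H →L[ℂ] H} (hT : IsCompactOperator T) :
    ∃ b : HilbertBasis ℕ ℂ H, Pairwise fun i j => inner ℂ (T (b i)) (T (b j)) = 0 := by
  have hK : IsCompactOperator (ContinuousLinearMap.adjoint T * T) :=
    hT.clm_comp (ContinuousLinearMap.adjoint T)
  obtain ⟨b, μ, hb⟩ := exists_hilbertBasis_eigenvectors hH hK
    (IsSelfAdjoint.star_mul_self T).isSymmetric
  refine ⟨b, fun i j hij => ?_⟩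
  have h : inner ℂ (T (b i)) (T (b j)) = inner ℂ (b i) ((ContinuousLinearMap.adjoint T * T) (b j)) :=
    (ContinuousLinearMap.adjoint_inner_right T _ _).symm
  change inner ℂ (T (b i)) (T (b j)) = 0
  rw [h, hb, inner_smul_right, b.orthonormal.inner_eq_zero hij, mul_zero]

/-- An operator mapping a Hilbert basis to pairwise orthogonal vectors is the product of a bounded
operator and a diagonal one. -/
theorem HilbertBasis.exists_eq_mul_diagonal (b : HilbertBasis ι ℂ H) {T D : H →L[ℂ] H}
    (hT : Pairwise fun i j => inner ℂ (T (b i)) (T (b j)) = 0)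
    (hD : ∀ i, D (b i) = (‖T (b i)‖ : ℂ) • b i) : ∃ U : H →L[ℂ] H, T = U * D := by
  -- `U` sends basis vectors to the normalised images; since `0⁻¹ = 0`, it vanishes on those `b i`
  -- that `T` kills.
  obtain ⟨U, -, hU⟩ := b.exists_clm_apply_eq (w := fun i => ((‖T (b i)‖ : ℂ)⁻¹) • T (b i)) (C := 1)
    (fun i j hij => by simp [hT hij]) zero_le_one
    (fun i => by
      rw [norm_smul, norm_inv, Complex.norm_real, norm_norm]
      exact inv_mul_le_one)
  refine ⟨U, b.clm_ext fun i => ?_⟩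
  rw [mul_apply_eq_comp, hD, map_smul, hU, smul_smul]
  by_cases h : T (b i) = 0
  · simp [h]
  · rw [mul_inv_cancel₀ (by simpa using h), one_smul]

end Schmidt

/-! ### Construction of spectral measures and their integrals -/

namespace SpectralMeasure

variable {X : Type*} [MeasurableSpace X] {H : Type*} [NormedAddCommGroup H]
  [InnerProductSpace ℂ H] [CompleteSpace H]

theorem scalarMeasure_apply (E : SpectralMeasure X H) (x : H) {s : Set X} (hs : MeasurableSet s) :
    E.scalarMeasure x s = ENNReal.ofReal (‖E.proj s x‖ ^ 2) :=
  Measure.ofMeasurable_apply s hs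

instance isFiniteMeasure_scalarMeasure (E : SpectralMeasure X H) (x : H) :
    IsFiniteMeasure (E.scalarMeasure x) :=
  ⟨by rw [E.scalarMeasure_apply x MeasurableSet.univ]; exact ENNReal.ofReal_lt_top⟩

theorem inner_proj_self (E : SpectralMeasure X H) {s : Set X} (hs : MeasurableSet s) (x : H) :
    inner ℂ x (E.proj s x) = ((‖E.proj s x‖ ^ 2 : ℝ) : ℂ) := by
  have hP := E.isStarProjection s hs
  have h1 : E.proj s (E.proj s x) = E.proj s x :=
    congrArg (fun A : H →L[ℂ] H => A x) hP.isIdempotentElem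
  have h2 : inner ℂ (E.proj s x) (E.proj s x) = inner ℂ x (E.proj s (E.proj s x)) :=
    hP.isSelfAdjoint.isSymmetric x (E.proj s x)
  rw [h1] at h2
  rw [← h2, inner_self_eq_norm_sq_to_K]
  norm_cast

theorem hasIntegral_indicator (E : SpectralMeasure X H) {s : Set X} (hs : MeasurableSet s) :
    E.HasIntegral (s.indicator 1) (E.proj s) := by
  intro x
  refine ⟨(integrable_const (1 : ℂ)).indicator hs, ?_⟩
  rw [integral_indicator hs, E.inner_proj_self hs]
  simp [measureReal_def, E.scalarMeasure_apply x hs]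

theorem hasIntegral_one (E : SpectralMeasure X H) : E.HasIntegral 1 1 := by
  have := E.hasIntegral_indicator MeasurableSet.univ
  rwa [Set.indicator_univ, E.univ] at this

theorem hasIntegral_zero (E : SpectralMeasure X H) : E.HasIntegral 0 0 := by
  have := E.hasIntegral_indicator MeasurableSet.empty
  rwa [Set.indicator_empty', E.proj_empty] at this

/-- A multiplicative projection-valued set function whose quadratic forms are measures is a spectral
measure. -/
def ofMeasure (P : Set X → H →L[ℂ] H) (hP : ∀ s, MeasurableSet s → IsStarProjection (P s))
    (hmul : ∀ s t, MeasurableSet s → MeasurableSet t → P s * P t = P (s ∩ t))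
    (huniv : P Set.univ = 1) (ν : H → Measure X)
    (hν : ∀ x s, MeasurableSet s → ν x s = ENNReal.ofReal (‖P s x‖ ^ 2)) :
    SpectralMeasure X H where
  proj := P
  isStarProjection := hP
  univ := huniv
  hasSum_iUnion := by
    intro f hf hd x
    have hsymm : ∀ s, MeasurableSet s → ∀ y z, inner ℂ (P s y) z = inner ℂ y (P s z) :=
      fun s hs => (hP s hs).isSelfAdjoint.isSymmetric
    have hU : MeasurableSet (⋃ i, f i) := MeasurableSet.iUnion hf
    have happ : ∀ s t, MeasurableSet s → MeasurableSet t → ∀ y, P s (P t y) = P (s ∩ t) y :=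
      fun s t hs ht y => congrArg (fun A : H →L[ℂ] H => A y) (hmul s t hs ht)
    have hempty : ∀ y, P ∅ y = 0 := by
      intro y
      have h := hν y ∅ MeasurableSet.empty
      rw [measure_empty, eq_comm, ENNReal.ofReal_eq_zero] at h
      have : ‖P ∅ y‖ = 0 := pow_eq_zero_iff two_ne_zero |>.mp (le_antisymm h (by positivity))
      simpa using this
    have horth : Pairwise fun i j => inner ℂ (P (f i) x) (P (f j) x) = 0 := by
      intro i j hij
      rw [hsymm _ (hf i), happ _ _ (hf i) (hf j), (hd hij).inter_eq, hempty, inner_zero_right]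
    have hnorm : HasSum (fun i => ‖P (f i) x‖ ^ 2) (‖P (⋃ i, f i) x‖ ^ 2) := by
      have h := measure_iUnion (μ := ν x) hd hf
      rw [hν x _ hU] at h
      simp_rw [hν x _ (hf _)] at h
      have hne : ∑' i, ENNReal.ofReal (‖P (f i) x‖ ^ 2) ≠ ∞ := h ▸ ENNReal.ofReal_ne_top
      have h3 := ENNReal.hasSum_toReal hne
      rw [← ENNReal.tsum_toReal_eq (fun _ => ENNReal.ofReal_ne_top), ← h,
        ENNReal.toReal_ofReal (by positivity)] at h3
      simpa only [ENNReal.toReal_ofReal (sq_nonneg _)] using h3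
    -- Strong convergence follows from additivity of the quadratic forms: the pieces are orthogonal
    -- and dominated by the projection of the union, so the squared distance is the missing part of
    -- the measure `ν x`.
    have hdist : ∀ F : Finset ℕ, ‖(∑ i ∈ F, P (f i) x) - P (⋃ i, f i) x‖ ^ 2 =
        ‖P (⋃ i, f i) x‖ ^ 2 - ∑ i ∈ F, ‖P (f i) x‖ ^ 2 := by
      intro F
      have h1 : ‖∑ i ∈ F, P (f i) x‖ ^ 2 = ∑ i ∈ F, ‖P (f i) x‖ ^ 2 := by
        simpa using norm_sq_sum_smul_of_pairwise_inner_eq_zero horth (fun _ => 1) F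
      have h2 : inner ℂ (∑ i ∈ F, P (f i) x) (P (⋃ i, f i) x) =
          ((∑ i ∈ F, ‖P (f i) x‖ ^ 2 : ℝ) : ℂ) := by
        rw [sum_inner, Complex.ofReal_sum]
        refine Finset.sum_congr rfl fun i _ => ?_
        have h3 := hsymm _ (hf i) (P (f i) x) x
        rw [happ _ _ (hf i) (hf i), Set.inter_self] at h3
        rw [← hsymm _ hU, happ _ _ hU (hf i), Set.inter_eq_right.mpr (Set.subset_iUnion f i), h3,
          inner_self_eq_norm_sq_to_K]
        norm_cast
      have h4 : RCLike.re (inner ℂ (∑ i ∈ F, P (f i) x) (P (⋃ i, f i) x)) =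
          ∑ i ∈ F, ‖P (f i) x‖ ^ 2 := by
        rw [h2]
        exact Complex.ofReal_re _
      rw [@norm_sub_sq ℂ, h1, h4]
      ring
    rw [HasSum, tendsto_iff_norm_sub_tendsto_zero]
    have ht : Tendsto (fun F : Finset ℕ => ‖(∑ i ∈ F, P (f i) x) - P (⋃ i, f i) x‖ ^ 2) atTop
        (𝓝 0) := by
      simp_rw [hdist]
      have h := (tendsto_const_nhds (x := ‖P (⋃ i, f i) x‖ ^ 2)).sub hnorm
      rw [sub_self] at h
      exact h
    have := ht.sqrt
    simpa using this

theorem scalarMeasure_ofMeasure (P : Set X → H →L[ℂ] H)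
    (hP : ∀ s, MeasurableSet s → IsStarProjection (P s))
    (hmul : ∀ s t, MeasurableSet s → MeasurableSet t → P s * P t = P (s ∩ t))
    (huniv : P Set.univ = 1) (ν : H → Measure X)
    (hν : ∀ x s, MeasurableSet s → ν x s = ENNReal.ofReal (‖P s x‖ ^ 2)) (x : H) :
    (ofMeasure P hP hmul huniv ν hν).scalarMeasure x = ν x := by
  ext s hs
  rw [scalarMeasure_apply _ x hs, hν x s hs]
  rfl

/-- The spectral measure on the index set of a Hilbert basis that is diagonal in that basis. -/
theorem exists_of_hilbertBasis (b : HilbertBasis ℕ ℂ H) :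
    ∃ E : SpectralMeasure ℕ H, ∀ s i, E.proj s (b i) = s.indicator (1 : ℕ → ℂ) i • b i := by
  classical
  have hex : ∀ s : Set ℕ, ∃ T : H →L[ℂ] H, ∀ i, T (b i) = s.indicator (1 : ℕ → ℂ) i • b i := by
    intro s
    obtain ⟨T, -, hT⟩ := b.exists_diagonal (s.indicator (1 : ℕ → ℂ)) zero_le_one (fun i => by
      by_cases h : i ∈ s <;> simp [h])
    exact ⟨T, hT⟩
  choose P hP using hex
  have hin : ∀ s i x, inner ℂ (b i) (P s x) = s.indicator (1 : ℕ → ℂ) i * inner ℂ (b i) x :=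
    fun s i x => b.inner_diagonal (hP s) i x
  have hmul : ∀ s t, P s * P t = P (s ∩ t) := by
    intro s t
    refine b.clm_ext fun i => ?_
    rw [mul_apply_eq_comp, hP, map_smul, hP, hP, smul_smul, mul_comm]
    congr 1
    by_cases h1 : i ∈ s <;> by_cases h2 : i ∈ t <;> simp [h1, h2]
  refine ⟨ofMeasure P (fun s _ => ⟨?_, ?_⟩) (fun s t _ _ => hmul s t) ?_
    (fun x => Measure.sum fun i => ENNReal.ofReal (‖inner ℂ (b i) x‖ ^ 2) • Measure.dirac i) ?_,
    fun s i => hP s i⟩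
  · have := hmul s s
    rwa [Set.inter_self] at this
  · rw [ContinuousLinearMap.isSelfAdjoint_iff_isSymmetric]
    intro x y
    change inner ℂ (P s x) y = inner ℂ x (P s y)
    rw [← b.tsum_inner_mul_inner, ← b.tsum_inner_mul_inner x]
    refine tsum_congr fun i => ?_
    rw [hin, ← inner_conj_symm, hin, ← inner_conj_symm x]
    by_cases h : i ∈ s <;> simp [h]
  · refine b.clm_ext fun i => ?_
    rw [hP]
    simp
  · intro x s hs
    rw [Measure.sum_apply _ hs, ← (b.hasSum_norm_sq (P s x)).tsum_eq,
      ENNReal.ofReal_tsum_of_nonneg (fun _ => by positivity) (b.hasSum_norm_sq (P s x)).summable]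
    refine tsum_congr fun i => ?_
    rw [hin]
    by_cases h : i ∈ s <;> simp [h]

end SpectralMeasure

/-! ### Multiplication operators on `L²` and shifts of a basis -/

section Multiplication

theorem norm_indicator_one_le {Y : Type*} (s : Set Y) (x : Y) : ‖s.indicator (1 : Y → ℂ) x‖ ≤ 1 := by
  by_cases h : x ∈ s <;> simp [h]

variable {X : Type*} [MeasurableSpace X] {μ : Measure X}

/-- Multiplication by an essentially bounded function on `L²`. -/
noncomputable def mulLpTwo (g : X → ℂ) (hg : MemLp g ∞ μ) : Lp ℂ 2 μ →L[ℂ] Lp ℂ 2 μ :=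
  (ContinuousLinearMap.mul ℂ ℂ).holderL μ ∞ 2 2 (hg.toLp g)

theorem coeFn_mulLpTwo {g : X → ℂ} (hg : MemLp g ∞ μ) (f : Lp ℂ 2 μ) :
    mulLpTwo g hg f =ᵐ[μ] fun x => g x * f x := by
  have h : mulLpTwo g hg f =ᵐ[μ] fun x => (hg.toLp g) x * f x :=
    ContinuousLinearMap.coeFn_holder (ContinuousLinearMap.mul ℂ ℂ) (hg.toLp g) f
  filter_upwards [h, hg.coeFn_toLp] with x h1 h2
  rw [h1, h2]

theorem ofReal_norm_sq_eq_lintegral (f : Lp ℂ 2 μ) :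
    ENNReal.ofReal (‖f‖ ^ 2) = ∫⁻ x, ‖f x‖ₑ ^ 2 ∂μ := by
  have h := eLpNorm_nnreal_pow_eq_lintegral (f := f) (μ := μ) (p := 2) two_ne_zero
  rw [ENNReal.ofReal_pow (norm_nonneg _), ofReal_norm, Lp.enorm_def]
  simpa using h

theorem inner_mulLpTwo {g : X → ℂ} (hg : MemLp g ∞ μ) (f : Lp ℂ 2 μ) :
    inner ℂ f (mulLpTwo g hg f) = ∫ x, g x ∂(μ.withDensity fun x => ‖f x‖ₑ ^ 2) := by
  rw [L2.inner_def, integral_withDensity_eq_integral_toReal_smul₀]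
  · refine integral_congr_ae ?_
    filter_upwards [coeFn_mulLpTwo hg f] with x hx
    rw [hx]
    simp only [RCLike.inner_apply, ENNReal.toReal_pow, toReal_enorm, Complex.real_smul,
      Complex.ofReal_pow]
    rw [mul_assoc, Complex.mul_conj, Complex.normSq_eq_norm_sq]
    push_cast
    ring
  · exact (Lp.aestronglyMeasurable f).enorm.pow_const 2
  · exact Eventually.of_forall fun x => by simp

theorem memLp_top_of_norm_le_one {g : X → ℂ} (hg : Measurable g) (h : ∀ x, ‖g x‖ ≤ 1) :
    MemLp g ∞ μ :=
  memLp_top_of_bound hg.aestronglyMeasurable 1 (Eventually.of_forall h)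

theorem measurable_indicator_one {s : Set X} (hs : MeasurableSet s) :
    Measurable (s.indicator (1 : X → ℂ)) :=
  measurable_one.indicator hs

variable {H : Type*} [NormedAddCommGroup H] [InnerProductSpace ℂ H] [CompleteSpace H]

/-- On a space identified with `L²(μ)` there is a spectral measure whose spectral integrals are the
multiplication operators. -/
theorem SpectralMeasure.exists_of_linearIsometryEquiv (U : H ≃ₗᵢ[ℂ] Lp ℂ 2 μ) :
    ∃ E : SpectralMeasure X H, ∀ g : X → ℂ, Measurable g → (∀ x, ‖g x‖ ≤ 1) →
      ∃ B : H →L[ℂ] H, E.HasIntegral g B ∧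
        ∀ x, U (B x) =ᵐ[μ] fun t => g t * U x t := by
  classical
  let conj : (Lp ℂ 2 μ →L[ℂ] Lp ℂ 2 μ) → (H →L[ℂ] H) := fun M =>
    (U.symm.toContinuousLinearEquiv : Lp ℂ 2 μ →L[ℂ] H).comp
      (M.comp (U.toContinuousLinearEquiv : H →L[ℂ] Lp ℂ 2 μ))
  have hconj : ∀ M x, U (conj M x) = M (U x) := fun M x => U.apply_symm_apply _
  let P : Set X → H →L[ℂ] H := fun s =>
    if hs : MeasurableSet s then conj (mulLpTwo (s.indicator 1)
      (memLp_top_of_norm_le_one (measurable_indicator_one hs) (norm_indicator_one_le s))) else 0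
  have hP : ∀ s, MeasurableSet s → ∀ x, U (P s x) =ᵐ[μ] fun t => s.indicator 1 t * U x t := by
    intro s hs x
    simp only [P, dif_pos hs, hconj]
    exact coeFn_mulLpTwo _ _
  have hmul : ∀ s t, MeasurableSet s → MeasurableSet t → P s * P t = P (s ∩ t) := by
    intro s t hs ht
    ext x
    apply U.injective
    apply Lp.ext
    rw [mul_apply_eq_comp]
    filter_upwards [hP s hs (P t x), hP t ht x, hP _ (hs.inter ht) x] with y h1 h2 h3
    rw [h1, h2, h3]
    by_cases h1 : y ∈ s <;> by_cases h2 : y ∈ t <;> simp [h1, h2]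
  have hself : ∀ s, MeasurableSet s → IsSelfAdjoint (P s) := by
    intro s hs
    rw [ContinuousLinearMap.isSelfAdjoint_iff_isSymmetric]
    intro x y
    change inner ℂ (P s x) y = inner ℂ x (P s y)
    rw [← U.inner_map_map, ← U.inner_map_map x, L2.inner_def, L2.inner_def]
    refine integral_congr_ae ?_
    filter_upwards [hP s hs x, hP s hs y] with t h1 h2
    rw [h1, h2]
    by_cases h : t ∈ s <;> simp [h]
  have huniv : P Set.univ = 1 := by
    ext x
    apply U.injective
    apply Lp.ext
    filter_upwards [hP _ MeasurableSet.univ x] with t h1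
    rw [h1]
    simp
  have hν : ∀ x s, MeasurableSet s →
      (μ.withDensity fun t => ‖U x t‖ₑ ^ 2) s = ENNReal.ofReal (‖P s x‖ ^ 2) := by
    intro x s hs
    rw [withDensity_apply _ hs, ← U.norm_map, ofReal_norm_sq_eq_lintegral, ← lintegral_indicator hs]
    refine lintegral_congr_ae ?_
    filter_upwards [hP s hs x] with t h1
    rw [h1]
    by_cases h : t ∈ s <;> simp [h]
  refine ⟨SpectralMeasure.ofMeasure P (fun s hs => ⟨?_, hself s hs⟩) hmul huniv _ hν, ?_⟩
  · have := hmul s s hs hs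
    rwa [Set.inter_self] at this
  · intro g hm hg
    refine ⟨conj (mulLpTwo g (memLp_top_of_norm_le_one hm hg)), fun x => ⟨?_, ?_⟩, fun x => ?_⟩
    · exact Integrable.of_bound hm.aestronglyMeasurable 1 (Eventually.of_forall hg)
    · rw [scalarMeasure_ofMeasure, ← U.inner_map_map, hconj, inner_mulLpTwo]
    · rw [hconj]
      exact coeFn_mulLpTwo _ _

/-- For every Hilbert basis there is a spectral measure such that any basis vector is mapped to any
other one by the spectral integral of some function bounded by one. -/
theorem SpectralMeasure.exists_shift (b : HilbertBasis ℕ ℂ H) :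
    ∃ E : SpectralMeasure UnitAddCircle H, ∀ k l : ℕ, ∃ (g : UnitAddCircle → ℂ) (B : H →L[ℂ] H),
      Measurable g ∧ (∀ x, ‖g x‖ ≤ 1) ∧ E.HasIntegral g B ∧ B (b l) = b k := by
  classical
  obtain ⟨e⟩ := nonempty_equiv_of_countable (α := ℕ) (β := ℤ)
  obtain ⟨f, hf⟩ := (fourierBasis (T := 1)).exists_reindex e
  let U := b.repr.trans f.repr.symm
  have hU : ∀ k, U (b k) = fourierLp 2 (e k) := by
    intro k
    change f.repr.symm (b.repr (b k)) = _
    rw [b.repr_self, f.repr_symm_single, hf, coe_fourierBasis]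
  obtain ⟨E, hE⟩ := SpectralMeasure.exists_of_linearIsometryEquiv U
  refine ⟨E, fun k l => ?_⟩
  -- Multiplying the character of frequency `e l` by that of frequency `e k - e l` gives the one of
  -- frequency `e k`.
  have hm : Measurable (fourier (T := 1) (e k - e l) : UnitAddCircle → ℂ) :=
    (fourier (e k - e l)).continuous.measurable
  have hg : ∀ x : UnitAddCircle, ‖fourier (e k - e l) x‖ ≤ 1 := fun x => by
    rw [fourier_apply, Circle.norm_coe]
  obtain ⟨B, hB, hBU⟩ := hE _ hm hg
  refine ⟨_, B, hm, hg, hB, ?_⟩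
  apply U.injective
  apply Lp.ext
  rw [hU k]
  filter_upwards [hBU (b l), coeFn_fourierLp 2 (e k) (T := 1), coeFn_fourierLp 2 (e l) (T := 1)]
    with t h1 h2 h3
  rw [h1, hU l, h2, h3, ← fourier_add, sub_add_cancel]

end Multiplication

/-! ### Box sums and multiple operator integrals with diagonal coefficients -/

theorem eq_const_of_forall_castSucc_eq_succ {n : ℕ} {α : Type*} {j : Fin (n + 1) → α}
    (h : ∀ i : Fin n, j i.castSucc = j i.succ) (i : Fin (n + 1)) : j i = j 0 := by
  induction i using Fin.induction with
  | zero => rfl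
  | succ i ih => rw [← h i, ih]

/-- Box sums of a function supported on the diagonal converge to the sum over the diagonal. -/
theorem tendsto_sum_indexBox_of_diagonal {n : ℕ} {M : Type*} [AddCommMonoid M] [TopologicalSpace M]
    {f : (Fin (n + 1) → ℕ) → M}
    (hf : ∀ j, (∃ i : Fin n, j i.castSucc ≠ j i.succ) → f j = 0) {a : M}
    (h : HasSum (fun k : ℕ => f fun _ => k) a) :
    Tendsto (fun L => ∑ j ∈ indexBox L, f j) atTop (𝓝 a) := by
  classical
  -- The diagonal meets the box exactly in the indices below its shortest side.
  let m : (Fin (n + 1) → ℕ) → ℕ := fun L => Finset.univ.inf' Finset.univ_nonempty L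
  have hm : Tendsto m atTop atTop := by
    refine tendsto_atTop.mpr fun c => ?_
    filter_upwards [eventually_ge_atTop (fun _ : Fin (n + 1) => c)] with L hL
    exact Finset.le_inf' _ _ fun i _ => hL i
  refine (h.tendsto_sum_nat.comp hm).congr fun L => ?_
  have hinj : Function.Injective (fun (k : ℕ) (_ : Fin (n + 1)) => k) :=
    fun k l hkl => congrFun hkl 0
  rw [Function.comp_apply, ← Finset.sum_image (f := f) (g := fun (k : ℕ) (_ : Fin (n + 1)) => k)
    (fun k _ l _ hkl => hinj hkl)]
  refine Finset.sum_subset ?_ ?_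
  · intro j hj
    obtain ⟨k, hk, rfl⟩ := Finset.mem_image.mp hj
    rw [Finset.mem_range] at hk
    simp only [indexBox, Fintype.mem_piFinset, Finset.mem_range]
    exact fun i => hk.trans_le (Finset.inf'_le _ (Finset.mem_univ i))
  · intro j hj hnot
    apply hf
    by_contra! hcon
    have hconst := eq_const_of_forall_castSucc_eq_succ hcon
    refine hnot (Finset.mem_image.mpr ⟨j 0, ?_, funext fun i => (hconst i).symm⟩)
    simp only [indexBox, Fintype.mem_piFinset, Finset.mem_range] at hj
    rw [Finset.mem_range]
    refine (Finset.lt_inf'_iff _).mpr fun i _ => ?_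
    rw [← hconst i]
    exact hj i

theorem list_prod_ofFn_eq_zero {n : ℕ} {R : Type*} [MonoidWithZero R] {f : Fin n → R} {i : Fin n}
    (h : f i = 0) : (List.ofFn f).prod = 0 :=
  List.prod_eq_zero (h ▸ List.mem_ofFn.mpr ⟨i, rfl⟩)

section Diagonal

variable {H : Type*} [NormedAddCommGroup H] [InnerProductSpace ℂ H] [CompleteSpace H]

theorem SpectralMeasure.memLinftyB_diagonal {X : Type*} [MeasurableSpace X]
    (E : SpectralMeasure X H) {β : ℕ → X → ℂ} (hm : ∀ j, Measurable (β j))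
    (hβ : ∀ j x, ‖β j x‖ ≤ 1) :
    E.MemLinftyB fun j k x => if j = k then β j x else 0 := by
  classical
  refine ⟨fun j k => ?_, 1, ∅, ⟨MeasurableSet.empty, E.proj_empty⟩, fun x _ => ?_⟩
  · by_cases h : j = k
    · simpa [h] using hm k
    · simp [h]
  -- This is the standard basis of `ℓ²`, in which the matrix acts diagonally with entries of modulus
  -- at most one.
  · let b : HilbertBasis ℕ ℂ (lp (fun _ : ℕ => ℂ) 2) := ⟨LinearIsometryEquiv.refl ℂ _⟩
    have hb : ∀ k, b k = lp.single 2 k (1 : ℂ) := fun k => (b.repr_symm_single k).symm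
    obtain ⟨M, hM, hMb⟩ := b.exists_diagonal (fun j => β j x) zero_le_one (fun j => hβ j x)
    refine ⟨M, hM, fun j k => ?_⟩
    have h := hMb k
    rw [hb] at h
    rw [h]
    by_cases hjk : j = k
    · subst hjk
      simp
    · simp [hjk]

theorem SpectralMeasure.memLinftyL2_of_forall_le {X : Type*} [MeasurableSpace X]
    (E : SpectralMeasure X H) {α : ℕ → X → ℂ} (hm : ∀ j, Measurable (α j))
    (hα : ∀ x, ∑' j, ‖α j x‖ₑ ^ 2 ≤ 1) : E.MemLinftyL2 α :=
  ⟨hm, 1, ∅, ⟨MeasurableSet.empty, E.proj_empty⟩, fun x _ => by simpa using hα x⟩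

theorem summable_norm_sq_of_tsum_enorm_sq_le_one {a : ℕ → ℂ} (h : ∑' j, ‖a j‖ₑ ^ 2 ≤ 1) :
    Summable fun j => ‖a j‖ ^ 2 := by
  have h1 := ENNReal.summable_toReal (ne_top_of_le_ne_top ENNReal.one_ne_top h)
  simpa using h1

/-- A weakly convergent series `∑ A_j T_1 B_j T_2 ⋯ T_{m-1} D_j` is the multiple operator integral
of the function whose representation has diagonal intermediate coefficients. -/
theorem exists_isMultipleOperatorIntegral_of_hasSum {n : ℕ} {X : Fin (n + 2) → Type*}
    [∀ i, MeasurableSpace (X i)] (E : ∀ i, SpectralMeasure (X i) H)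
    {α : ℕ → X 0 → ℂ} (hαm : ∀ j, Measurable (α j)) (hα : ∀ x, ∑' j, ‖α j x‖ₑ ^ 2 ≤ 1)
    {β : ∀ i : Fin n, ℕ → X i.succ.castSucc → ℂ} (hβm : ∀ i j, Measurable (β i j))
    (hβ : ∀ i j x, ‖β i j x‖ ≤ 1)
    {δ : ℕ → X (Fin.last (n + 1)) → ℂ} (hδm : ∀ j, Measurable (δ j))
    (hδ : ∀ x, ∑' j, ‖δ j x‖ₑ ^ 2 ≤ 1)
    {A : ℕ → H →L[ℂ] H} {B : Fin n → ℕ → H →L[ℂ] H} {D : ℕ → H →L[ℂ] H}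
    (hA : ∀ j, (E 0).HasIntegral (α j) (A j))
    (hB : ∀ i j, (E i.succ.castSucc).HasIntegral (β i j) (B i j))
    (hD : ∀ j, (E (Fin.last (n + 1))).HasIntegral (δ j) (D j))
    (T : Fin (n + 1) → H →L[ℂ] H) (W : H →L[ℂ] H)
    (hW : ∀ x y, HasSum (fun j => inner ℂ x
      ((A j * (List.ofFn fun i : Fin n => T i.castSucc * B i j).prod * T (Fin.last n) * D j) y))
      (inner ℂ x (W y))) :
    ∃ Ψ : (∀ i, X i) → ℂ, MemHaagerup E Ψ ∧ IsMultipleOperatorIntegral E Ψ T W := by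
  classical
  let R : HaagerupData E :=
    { left := α
      mid := fun i j k x => if j = k then β i j x else 0
      right := δ
      left_mem := (E 0).memLinftyL2_of_forall_le hαm hα
      mid_mem := fun i => (E _).memLinftyB_diagonal (hβm i) (hβ i)
      right_mem := (E _).memLinftyL2_of_forall_le hδm hδ }
  let term : (∀ i, X i) → ℕ → ℂ := fun x k =>
    α k (x 0) * (∏ i : Fin n, β i k (x i.succ.castSucc)) * δ k (x (Fin.last (n + 1)))
  have hsum : ∀ x, Summable (term x) := by
    intro x
    -- The intermediate factors have modulus at most one, so `|α_k δ_k| ≤ |α_k|² + |δ_k|²` dominates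
    -- the terms.
    refine Summable.of_norm_bounded
      ((summable_norm_sq_of_tsum_enorm_sq_le_one (hα (x 0))).add
        (summable_norm_sq_of_tsum_enorm_sq_le_one (hδ (x (Fin.last (n + 1)))))) fun k => ?_
    have hp : ‖∏ i : Fin n, β i k (x i.succ.castSucc)‖ ≤ 1 := by
      rw [norm_prod]
      exact Finset.prod_le_one (fun _ _ => norm_nonneg _) fun i _ => hβ i k _
    have h1 := norm_nonneg (α k (x 0))
    have h2 := norm_nonneg (δ k (x (Fin.last (n + 1))))
    calc ‖term x k‖ = ‖α k (x 0)‖ * ‖∏ i : Fin n, β i k (x i.succ.castSucc)‖ *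
          ‖δ k (x (Fin.last (n + 1)))‖ := by simp only [term, norm_mul]
      _ ≤ ‖α k (x 0)‖ * 1 * ‖δ k (x (Fin.last (n + 1)))‖ := by gcongr
      _ ≤ _ := by nlinarith [sq_nonneg (‖α k (x 0)‖ - ‖δ k (x (Fin.last (n + 1)))‖)]
  have hR : R.Represents fun x => ∑' k, term x k := by
    refine ⟨fun _ => ∅, fun i => ⟨MeasurableSet.empty, (E i).proj_empty⟩, fun x _ => ?_⟩
    refine tendsto_sum_indexBox_of_diagonal ?_ ?_
    · rintro j ⟨i, hi⟩
      rw [Finset.prod_eq_zero (Finset.mem_univ i) (if_neg hi)]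
      simp
    · simpa [R, term] using (hsum x).hasSum
  refine ⟨_, ⟨R, hR⟩, R, hR, A, fun i j k => if j = k then B i j else 0, D, hA, ?_, hD, ?_⟩
  · intro i j k
    by_cases h : j = k
    · simpa [R, h] using hB i k
    · simp only [R, h, if_false]
      exact (E i.succ.castSucc).hasIntegral_zero
  · intro x y
    have hlin : ∀ s : Finset (Fin (n + 1) → ℕ), ∀ f : (Fin (n + 1) → ℕ) → H →L[ℂ] H,
        inner ℂ x ((∑ j ∈ s, f j) y) = ∑ j ∈ s, inner ℂ x (f j y) := by
      intro s f
      rw [sum_apply, inner_sum]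
    simp_rw [hlin]
    refine tendsto_sum_indexBox_of_diagonal ?_ ?_
    · rintro j ⟨i, hi⟩
      rw [list_prod_ofFn_eq_zero (i := i) (by simp [hi])]
      simp
    · simpa using hW x y

end Diagonal

/-! ### Image spectral measures and products along a chain of vectors -/

namespace SpectralMeasure

variable {X Y : Type*} [MeasurableSpace X] [MeasurableSpace Y] {H : Type*} [NormedAddCommGroup H]
  [InnerProductSpace ℂ H] [CompleteSpace H]

/-- The image of a spectral measure under a measurable map. -/
def map (E : SpectralMeasure X H) (f : X → Y) (hf : Measurable f) : SpectralMeasure Y H where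
  proj s := E.proj (f ⁻¹' s)
  isStarProjection s hs := E.isStarProjection _ (hf hs)
  univ := E.univ
  hasSum_iUnion g hg hd x := by
    rw [Set.preimage_iUnion]
    exact E.hasSum_iUnion _ (fun i => hf (hg i)) (fun i j hij => (hd hij).preimage f) x

theorem scalarMeasure_map (E : SpectralMeasure X H) {f : X → Y} (hf : Measurable f) (x : H) :
    (E.map f hf).scalarMeasure x = (E.scalarMeasure x).map f := by
  ext s hs
  rw [scalarMeasure_apply _ x hs, Measure.map_apply hf hs, scalarMeasure_apply _ x (hf hs)]
  rfl

theorem HasIntegral.map {E : SpectralMeasure X H} {f : X → Y} (hf : Measurable f) {g : Y → ℂ}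
    (hg : Measurable g) {A : H →L[ℂ] H} (h : E.HasIntegral (g ∘ f) A) :
    (E.map f hf).HasIntegral g A := by
  intro x
  rw [scalarMeasure_map, integrable_map_measure hg.aestronglyMeasurable hf.aemeasurable,
    integral_map hf.aemeasurable hg.aestronglyMeasurable]
  exact h x

/-- The spectral measure on a one-point space. -/
theorem nonempty_unit : Nonempty (SpectralMeasure Unit H) := by
  classical
  refine ⟨ofMeasure (fun s => if () ∈ s then 1 else 0) (fun s _ => ?_) (fun s t _ _ => ?_)
    (by simp) (fun x => ENNReal.ofReal (‖x‖ ^ 2) • Measure.dirac ()) (fun x s hs => ?_)⟩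
  · split_ifs
    exacts [IsStarProjection.one _, IsStarProjection.zero _]
  · by_cases h1 : () ∈ s <;> by_cases h2 : () ∈ t <;> simp [h1, h2]
  · by_cases h1 : () ∈ s <;> simp [h1]

end SpectralMeasure

theorem list_prod_ofFn_apply {n : ℕ} {H : Type*} [NormedAddCommGroup H] [InnerProductSpace ℂ H]
    (M : Fin n → H →L[ℂ] H) (x : Fin (n + 1) → H) (h : ∀ i : Fin n, M i (x i.succ) = x i.castSucc) :
    (List.ofFn M).prod (x (Fin.last n)) = x 0 := by
  induction n with
  | zero => simp
  | succ n ih =>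
    rw [List.ofFn_succ, List.prod_cons, mul_apply_eq_comp]
    have h1 := ih (fun i => M i.succ) (fun i => x i.succ) (fun i => h i.succ)
    rw [← Fin.succ_last, h1]
    exact h 0

/-! ### Realising diagonal operators as multiple operator integrals -/

section Factors

variable {H : Type*} [NormedAddCommGroup H] [InnerProductSpace ℂ H]

theorem HilbertBasis.exists_inner_eq (b : HilbertBasis ℕ ℂ H) {u : ℕ → ℂ}
    (hu : Summable fun j => ‖u j‖ ^ 2) : ∃ x : H, ∀ j, inner ℂ (b j) x = u j := by
  have hmem : Memℓp u 2 := by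
    refine memℓp_gen ?_
    simpa using hu
  refine ⟨b.repr.symm ⟨u, hmem⟩, fun j => ?_⟩
  rw [← b.repr_apply_apply, LinearIsometryEquiv.apply_symm_apply]

theorem smulRight_innerSL_mem_schattenClass (x y : H) {p : ℝ≥0∞} (hp : 0 < p) :
    (innerSL ℂ x).smulRight y ∈ schattenClass H p :=
  mem_schattenClass_of_rank_le (N := 1) (rank_le_one_of_forall_mem_span (w := y) fun _ =>
    Submodule.smul_mem _ _ (Submodule.mem_span_singleton_self y)) hp

theorem summable_rpow_max_two_of_lt {u : ℕ → ℂ} {p : ℝ≥0∞}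
    (hu : max p 2 ≠ ∞ → Summable fun j => ‖u j‖ ^ (max p 2).toReal) (h : p < 2) :
    Summable fun j => ‖u j‖ ^ 2 := by
  have := hu (by rw [max_eq_right h.le]; exact ENNReal.ofNat_ne_top)
  rw [max_eq_right h.le] at this
  simpa using this

variable [CompleteSpace H]

/-- A sequence of `ℓ^q`, `q = max p 2`, is read off from an operator of `S_p` by pairing the images
of suitable basis vectors with the basis. -/
theorem HilbertBasis.exists_schatten_inner_eq (b : HilbertBasis ℕ ℂ H) {u : ℕ → ℂ} {C : ℝ}
    (hC : ∀ j, ‖u j‖ ≤ C) {p : ℝ≥0∞} (hp : 0 < p)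
    (hu : max p 2 ≠ ∞ → Summable fun j => ‖u j‖ ^ (max p 2).toReal) :
    ∃ (T : H →L[ℂ] H) (γ : ℕ → ℕ), T ∈ schattenClass H p ∧
      ∀ j, inner ℂ (b j) (T (b (γ j))) = u j := by
  rcases lt_or_ge p 2 with h | h
  · obtain ⟨x, hx⟩ := b.exists_inner_eq (summable_rpow_max_two_of_lt hu h)
    -- All entries `u j` sit in the column of `b 0`, so a rank one operator suffices.
    refine ⟨(innerSL ℂ (b 0)).smulRight x, fun _ => 0, smulRight_innerSL_mem_schattenClass _ _ hp,
      fun j => ?_⟩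
    simp [hx, b.orthonormal.norm_eq_one]
  · rw [max_eq_left h] at hu
    obtain ⟨T, -, hT⟩ := b.exists_diagonal u ((norm_nonneg _).trans (hC 0)) hC
    refine ⟨T, id, b.mem_schattenClass_of_diagonal hT hp hu, fun j => ?_⟩
    simp [hT, b.orthonormal.norm_eq_one]

/-- A sequence of `ℓ^q`, `q = max p 2`, gives an operator of `S_p` that maps the basis vectors to
multiples of basis vectors with these coefficients. -/
theorem HilbertBasis.exists_schatten_apply_eq (b : HilbertBasis ℕ ℂ H) {u : ℕ → ℂ} {C : ℝ}
    (hC : ∀ j, ‖u j‖ ≤ C) {p : ℝ≥0∞} (hp : 0 < p)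
    (hu : max p 2 ≠ ∞ → Summable fun j => ‖u j‖ ^ (max p 2).toReal) :
    ∃ (T : H →L[ℂ] H) (φ : ℕ → ℕ), T ∈ schattenClass H p ∧ ∀ j, T (b j) = u j • b (φ j) := by
  rcases lt_or_ge p 2 with h | h
  · obtain ⟨x, hx⟩ := b.exists_inner_eq (u := fun j => (starRingEnd ℂ) (u j))
      (by simpa using summable_rpow_max_two_of_lt hu h)
    refine ⟨(innerSL ℂ x).smulRight (b 0), fun _ => 0, smulRight_innerSL_mem_schattenClass _ _ hp,
      fun j => ?_⟩
    have : inner ℂ x (b j) = u j := by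
      rw [← inner_conj_symm, hx, Complex.conj_conj]
    simp [this]
  · rw [max_eq_left h] at hu
    obtain ⟨T, -, hT⟩ := b.exists_diagonal u ((norm_nonneg _).trans (hC 0)) hC
    exact ⟨T, id, b.mem_schattenClass_of_diagonal hT hp hu, hT⟩

theorem tsum_enorm_sq_indicator_singleton_le {Y : Type*} {f : ℕ → Y} (hf : Function.Injective f)
    (y : Y) : ∑' j, ‖({f j} : Set Y).indicator (1 : Y → ℂ) y‖ₑ ^ 2 ≤ 1 := by
  classical
  by_cases h : ∃ j, f j = y
  · obtain ⟨j, rfl⟩ := h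
    rw [tsum_eq_single j]
    · simp
    · intro k hk
      simp [hf.ne hk.symm]
  · push Not at h
    have : ∀ j, ‖({f j} : Set Y).indicator (1 : Y → ℂ) y‖ₑ ^ 2 = 0 := fun j => by
      simp [(h j).symm]
    rw [tsum_congr this]
    simp

/-- The diagonal operator with entries `u_j v_j` is a multiple operator integral with operators from
the given Schatten classes. -/
theorem HilbertBasis.exists_isMultipleOperatorIntegral_diagonal (b : HilbertBasis ℕ ℂ H) {n : ℕ}
    (hn : 1 ≤ n) {p : Fin (n + 1) → ℝ≥0∞} (hp : ∀ j, 0 < p j) {u v : ℕ → ℂ} {C C' : ℝ}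
    (hC : ∀ j, ‖u j‖ ≤ C) (hC' : ∀ j, ‖v j‖ ≤ C')
    (hu : max (p 0) 2 ≠ ∞ → Summable fun j => ‖u j‖ ^ (max (p 0) 2).toReal)
    (hv : max (p (Fin.last n)) 2 ≠ ∞ →
      Summable fun j => ‖v j‖ ^ (max (p (Fin.last n)) 2).toReal) :
    ∃ (E : Fin (n + 2) → SpectralMeasure (ℕ ⊕ UnitAddCircle) H)
      (Ψ : (Fin (n + 2) → ℕ ⊕ UnitAddCircle) → ℂ) (T : Fin (n + 1) → H →L[ℂ] H) (W : H →L[ℂ] H),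
      MemHaagerup E Ψ ∧ (∀ j, T j ∈ schattenClass H (p j)) ∧
        IsMultipleOperatorIntegral E Ψ T W ∧ ∀ j, W (b j) = (u j * v j) • b j := by
  classical
  obtain ⟨T₀, γ, hT₀, hγ⟩ := b.exists_schatten_inner_eq hC (hp 0) hu
  obtain ⟨T₁, φ, hT₁, hφ⟩ := b.exists_schatten_apply_eq hC' (hp (Fin.last n)) hv
  obtain ⟨W, -, hW⟩ := b.exists_diagonal (fun j => u j * v j) (C := C * C')
    (mul_nonneg ((norm_nonneg _).trans (hC 0)) ((norm_nonneg _).trans (hC' 0)))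
    (fun j => by
      rw [norm_mul]
      exact mul_le_mul (hC j) (hC' j) (norm_nonneg _) ((norm_nonneg _).trans (hC j)))
  obtain ⟨Ed, hEd⟩ := SpectralMeasure.exists_of_hilbertBasis b
  obtain ⟨Ec, hEc⟩ := SpectralMeasure.exists_shift b
  choose g G hgm hg hG hGb using hEc
  -- This is where `m ≥ 3` enters: the factors carrying `u` and `v` are distinct operators.
  have h0last : (0 : Fin (n + 1)) ≠ Fin.last n := by
    rw [Ne, Fin.ext_iff, Fin.val_zero, Fin.val_last]
    omega
  -- Both kinds of spectral measure are pushed to one common space, so that the family does not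
  -- depend on `i` in its type.
  let E : Fin (n + 2) → SpectralMeasure (ℕ ⊕ UnitAddCircle) H := fun i =>
    if i = 0 ∨ i = Fin.last (n + 1) then Ed.map Sum.inl measurable_inl
    else Ec.map Sum.inr measurable_inr
  have hE0 : E 0 = Ed.map Sum.inl measurable_inl := if_pos (Or.inl rfl)
  have hE1 : E (Fin.last (n + 1)) = Ed.map Sum.inl measurable_inl := if_pos (Or.inr rfl)
  have hE : ∀ i : Fin n, E i.succ.castSucc = Ec.map Sum.inr measurable_inr := by
    intro i
    refine if_neg ?_
    rintro (h | h) <;> rw [Fin.ext_iff] at h <;> simp at h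
    omega
  let P : H →L[ℂ] H := (innerSL ℂ (b 0)).smulRight (b 0)
  have hP : P (b 0) = b 0 := by simp [P, b.orthonormal.norm_eq_one]
  let T : Fin (n + 1) → H →L[ℂ] H := fun i =>
    if i = 0 then T₀ else if i = Fin.last n then T₁ else P
  have hTlast : T (Fin.last n) = T₁ := by simp [T, h0last.symm]
  have hTS : ∀ j, T j ∈ schattenClass H (p j) := by
    intro j
    by_cases h : j = 0
    · subst h
      simpa [T] using hT₀
    by_cases h' : j = Fin.last n
    · subst h'
      rwa [hTlast]
    · simp only [T, h, h', if_false]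
      exact smulRight_innerSL_mem_schattenClass _ _ (hp j)
  -- The `i`-th shift moves `b (src i j)` to `b (dst i j)`. Reading from the right, the path starts
  -- at `b (φ j)`, where `T₁` lands, rests at `b 0`, which `P` fixes, and ends at `b (γ j)`, which
  -- feeds `T₀`. For `n = 1` a single shift does both ends.
  let src : Fin n → ℕ → ℕ := fun i j => if i.succ = Fin.last n then φ j else 0
  let dst : Fin n → ℕ → ℕ := fun i j => if i.castSucc = 0 then γ j else 0
  have hproj : ∀ j y, Ed.proj {j} y = inner ℂ (b j) y • b j := by
    intro j y
    have h : Ed.proj {j} = (innerSL ℂ (b j)).smulRight (b j) := by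
      refine b.clm_ext fun i => ?_
      rw [hEd]
      by_cases hij : i = j
      · subst hij
        simp [b.orthonormal.norm_eq_one]
      · simp [hij, b.orthonormal.inner_eq_zero (Ne.symm hij)]
    rw [h]
    simp
  have hterm : ∀ j y, (Ed.proj {j} *
      (List.ofFn fun i : Fin n => T i.castSucc * G (dst i j) (src i j)).prod * T (Fin.last n) *
      Ed.proj {j}) y = (u j * v j * inner ℂ (b j) y) • b j := by
    intro j y
    -- The successive vectors along this path; the scalar `v j` from `T₁` is pulled out beforehand.
    let x : Fin (n + 1) → H := fun i =>
      if i = 0 then T₀ (b (γ j)) else if i = Fin.last n then b (φ j) else b 0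
    have hchain := list_prod_ofFn_apply
      (fun i : Fin n => T i.castSucc * G (dst i j) (src i j)) x (fun i => by
        have hsrc : x i.succ = b (src i j) := by
          simp only [x, src, Fin.succ_ne_zero, if_false]
          split_ifs <;> rfl
        rw [mul_apply_eq_comp, hsrc, hGb]
        by_cases h : i.castSucc = 0
        · simp [T, x, dst, h]
        · simp [T, x, dst, h, hP, i.castSucc_lt_last.ne])
    have hxlast : x (Fin.last n) = b (φ j) := by simp [x, h0last.symm]
    have hx0 : x 0 = T₀ (b (γ j)) := by simp [x]
    rw [hxlast, hx0] at hchain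
    simp only [mul_apply_eq_comp, hTlast]
    simp only [hproj, map_smul, hφ, hchain, inner_smul_right, hγ, smul_smul]
    congr 1
    ring
  have hsing : ∀ j : ℕ, MeasurableSet ({Sum.inl j} : Set (ℕ ⊕ UnitAddCircle)) := by
    intro j
    rw [← Set.image_singleton]
    exact (measurableSet_singleton j).inl_image
  have hind : ∀ j : ℕ, (Ed.map Sum.inl measurable_inl :
      SpectralMeasure (ℕ ⊕ UnitAddCircle) H).HasIntegral
        (({Sum.inl j} : Set (ℕ ⊕ UnitAddCircle)).indicator 1) (Ed.proj {j}) := by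
    intro j
    have h := (Ed.map Sum.inl measurable_inl :
      SpectralMeasure (ℕ ⊕ UnitAddCircle) H).hasIntegral_indicator (hsing j)
    have h2 : (Ed.map Sum.inl measurable_inl :
        SpectralMeasure (ℕ ⊕ UnitAddCircle) H).proj {Sum.inl j} = Ed.proj {j} := by
      change Ed.proj (Sum.inl ⁻¹' {Sum.inl j}) = _
      congr 1
      ext k
      simp
    rwa [h2] at h
  obtain ⟨Ψ, hΨ, hI⟩ := exists_isMultipleOperatorIntegral_of_hasSum E
    (α := fun j => ({Sum.inl j} : Set (ℕ ⊕ UnitAddCircle)).indicator 1)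
    (fun j => measurable_indicator_one (hsing j))
    (tsum_enorm_sq_indicator_singleton_le Sum.inl_injective)
    (β := fun i j => Sum.elim 0 (g (dst i j) (src i j)))
    (fun i j => Measurable.sumElim measurable_zero (hgm _ _))
    (fun i j x => by
      rcases x with x | x
      · simp
      · exact hg _ _ x)
    (δ := fun j => ({Sum.inl j} : Set (ℕ ⊕ UnitAddCircle)).indicator 1)
    (fun j => measurable_indicator_one (hsing j))
    (tsum_enorm_sq_indicator_singleton_le Sum.inl_injective)
    (A := fun j => Ed.proj {j}) (B := fun i j => G (dst i j) (src i j))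
    (D := fun j => Ed.proj {j})
    (fun j => by rw [hE0]; exact hind j)
    (fun i j => by
      rw [hE]
      refine SpectralMeasure.HasIntegral.map _ (Measurable.sumElim measurable_zero (hgm _ _)) ?_
      rw [Sum.elim_comp_inr]
      exact hG _ _)
    (fun j => by rw [hE1]; exact hind j)
    T W
    -- The weak sum is the Parseval expansion of `(W y, x)` in the basis `b`.
    (fun x y => by
      have h := b.hasSum_inner_mul_inner x (W y)
      simp only [hterm, inner_smul_right]
      rw [show (fun j => u j * v j * inner ℂ (b j) y * inner ℂ x (b j)) =
        fun j => inner ℂ x (b j) * inner ℂ (b j) (W y) from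
          funext fun j => by rw [b.inner_diagonal hW]; ring]
      exact h)
  exact ⟨E, Ψ, T, W, hΨ, hTS, hI, hW⟩

/-- On a finite-dimensional space the identity is a multiple operator integral. -/
theorem exists_isMultipleOperatorIntegral_one [FiniteDimensional ℂ H] {n : ℕ}
    {p : Fin (n + 1) → ℝ≥0∞} (hp : ∀ j, 0 < p j) :
    ∃ (E : Fin (n + 2) → SpectralMeasure Unit H) (Ψ : (Fin (n + 2) → Unit) → ℂ)
      (T : Fin (n + 1) → H →L[ℂ] H), MemHaagerup E Ψ ∧ (∀ j, T j ∈ schattenClass H (p j)) ∧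
        IsMultipleOperatorIntegral E Ψ T 1 := by
  classical
  obtain ⟨E⟩ := SpectralMeasure.nonempty_unit (H := H)
  let α : ℕ → Unit → ℂ := fun j => if j = 0 then 1 else 0
  have hα : ∀ x, ∑' j, ‖α j x‖ₑ ^ 2 ≤ 1 := by
    intro x
    rw [tsum_eq_single 0 (fun j hj => by simp [α, hj])]
    simp [α]
  have hA : ∀ j, E.HasIntegral (α j) (if j = 0 then 1 else 0) := by
    intro j
    by_cases h : j = 0
    · simpa [α, h] using E.hasIntegral_one
    · simpa [α, h] using E.hasIntegral_zero
  -- Every `T j` is the identity, of finite rank here, and only the summand with index `0` is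
  -- nonzero.
  obtain ⟨Ψ, hΨ, hI⟩ := exists_isMultipleOperatorIntegral_of_hasSum (n := n) (fun _ => E)
    (α := α) (fun _ => measurable_from_top) hα (β := fun _ _ => 1) (fun _ _ => measurable_from_top)
    (fun _ _ _ => by simp) (δ := α) (fun _ => measurable_from_top) hα
    (A := fun j => if j = 0 then 1 else 0) (B := fun _ _ => 1)
    (D := fun j => if j = 0 then 1 else 0) hA (fun _ _ => E.hasIntegral_one) hA (fun _ => 1) 1
    (fun x y => by
      convert hasSum_single (0 : ℕ) ?_ using 1
      · simp
      · intro j hj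
        simp [hj])
  refine ⟨_, Ψ, _, hΨ, fun j => mem_schattenClass_of_rank_le (N := Module.finrank ℂ H) ?_ (hp j), hI⟩
  rw [Module.finrank_eq_rank]
  exact LinearMap.rank_le_domain _

end Factors

/-! ### Splitting the singular numbers and conclusion -/

/-- The exponents `r/P` and `r/Q` add up to one. Writing them through `1 / P` covers `P = ∞`, where
the exponent is `0` and the factor is `1`, even for `s = 0`. -/
theorem rpow_mul_rpow_of_one_div_eq {s : ℝ} (hs : 0 ≤ s) {r P Q : ℝ≥0∞} (hr0 : r ≠ 0)
    (hr : r ≠ ∞) (hP : P ≠ 0) (hQ : Q ≠ 0) (h : 1 / r = 1 / P + 1 / Q) :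
    s ^ (r.toReal * (1 / P).toReal) * s ^ (r.toReal * (1 / Q).toReal) = s := by
  have hP' : 1 / P ≠ ∞ := by simpa using hP
  have hQ' : 1 / Q ≠ ∞ := by simpa using hQ
  rw [← Real.rpow_add_of_nonneg hs (by positivity) (by positivity), ← mul_add,
    ← ENNReal.toReal_add hP' hQ', ← h, ENNReal.toReal_div, ENNReal.toReal_one,
    mul_one_div_cancel (ENNReal.toReal_pos hr0 hr).ne', Real.rpow_one]

/-- Here `m = n + 2`, the indices `0, …, m - 1` stand for `1, …, m`. -/
theorem theorem4p1 {H : Type*} [NormedAddCommGroup H] [InnerProductSpace ℂ H] [CompleteSpace H]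
    [TopologicalSpace.SeparableSpace H]
    (n : ℕ) (hm : 3 ≤ n + 2) (p : Fin (n + 1) → ℝ≥0∞) (hp : ∀ j, 0 < p j)
    (r : ℝ≥0∞) (hr : 1 / r = 1 / max (p 0) 2 + 1 / max (p (Fin.last n)) 2)
    (S : SymmQuasinormedIdeal H)
    (hS : ∀ (X : Fin (n + 2) → Type) [∀ i, MeasurableSpace (X i)]
      (E : ∀ i, SpectralMeasure (X i) H) (Ψ : (∀ i, X i) → ℂ) (T : Fin (n + 1) → H →L[ℂ] H),
      MemHaagerup E Ψ → (∀ j, T j ∈ schattenClass H (p j)) →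
      ∀ W : H →L[ℂ] H, IsMultipleOperatorIntegral E Ψ T W → W ∈ S.carrier) :
    schattenClass H r ⊆ (S.carrier : Set (H →L[ℂ] H)) := by
  have hmul : ∀ (A B : H →L[ℂ] H), B ∈ S.carrier → A * B ∈ S.carrier := by
    intro A B hB
    simpa using S.mul_mem A 1 ⟨B, hB⟩
  intro T hT
  by_cases hH : FiniteDimensional ℂ H
  · obtain ⟨E, Ψ, V, hΨ, hV, hI⟩ := exists_isMultipleOperatorIntegral_one (H := H) hp
    simpa using hmul T 1 (hS _ E Ψ V hΨ hV 1 hI)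
  have hP0 : max (p 0) 2 ≠ 0 := (lt_max_of_lt_right two_pos).ne'
  have hQ0 : max (p (Fin.last n)) 2 ≠ 0 := (lt_max_of_lt_right two_pos).ne'
  have hr0 : r ≠ 0 := by
    rintro rfl
    rw [ENNReal.div_zero one_ne_zero, eq_comm, ENNReal.add_eq_top] at hr
    rcases hr with h | h
    · simp at h
    · simp at h
  rcases eq_or_ne r ∞ with rfl | hrtop
  -- Here `T` need not be compact, but both outer exponents are infinite, so the constant sequences
  -- `1` are admissible and produce the identity.
  · obtain ⟨b⟩ := exists_hilbertBasis_nat hH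
    rw [ENNReal.div_top, eq_comm, add_eq_zero] at hr
    have hP : max (p 0) 2 = ∞ := by simpa using hr.1
    have hQ : max (p (Fin.last n)) 2 = ∞ := by simpa using hr.2
    obtain ⟨E, Ψ, V, W, hΨ, hV, hI, hW⟩ := b.exists_isMultipleOperatorIntegral_diagonal
      (by omega) hp (u := fun _ => 1) (v := fun _ => 1) (C := 1) (C' := 1) (by simp) (by simp)
      (fun h => absurd hP h) (fun h => absurd hQ h)
    have hW1 : W = 1 := b.clm_ext fun j => by simp [hW]
    simpa [hW1] using hmul T W (hS _ E Ψ V hΨ hV W hI)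
  · have hrpos : 0 < r.toReal := ENNReal.toReal_pos hr0 hrtop
    have hsum : Summable fun k => singularNumber T k ^ r.toReal := hT.resolve_left hrtop
    obtain ⟨b, hb⟩ := exists_hilbertBasis_pairwise_inner_eq_zero hH
      (isCompactOperator_of_tendsto_singularNumber (tendsto_singularNumber_of_summable hrpos hsum))
    have hσ := b.summable_norm_rpow_of_summable_singularNumber hb hrpos.le hsum
    -- Boundedness is all that is asked of a factor with `Q = ∞`; for finite `Q`, the power `Q` of
    -- the factor is `‖T (b j)‖ ^ r`, which is summable.
    have hbound : ∀ (Q : ℝ≥0∞) (j : ℕ),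
        ‖((‖T (b j)‖ ^ (r.toReal * (1 / Q).toReal) : ℝ) : ℂ)‖ ≤
          ‖T‖ ^ (r.toReal * (1 / Q).toReal) := by
      intro Q j
      rw [Complex.norm_real, Real.norm_of_nonneg (by positivity)]
      refine Real.rpow_le_rpow (norm_nonneg _) ?_ (by positivity)
      simpa [b.orthonormal.norm_eq_one] using T.le_opNorm (b j)
    have hpow : ∀ Q : ℝ≥0∞, Q ≠ 0 → Q ≠ ∞ → Summable fun j =>
        ‖((‖T (b j)‖ ^ (r.toReal * (1 / Q).toReal) : ℝ) : ℂ)‖ ^ Q.toReal := by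
      intro Q hQ hQtop
      convert hσ using 2 with j
      rw [Complex.norm_real, Real.norm_of_nonneg (by positivity), ← Real.rpow_mul (norm_nonneg _),
        ENNReal.toReal_div, ENNReal.toReal_one, mul_assoc,
        one_div_mul_cancel (ENNReal.toReal_pos hQ hQtop).ne', mul_one]
    obtain ⟨E, Ψ, V, W, hΨ, hV, hI, hW⟩ := b.exists_isMultipleOperatorIntegral_diagonal
      (by omega) hp (hbound (max (p 0) 2)) (hbound (max (p (Fin.last n)) 2))
      (hpow _ hP0) (hpow _ hQ0)
    obtain ⟨U, hU⟩ := b.exists_eq_mul_diagonal (D := W) hb (fun j => by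
      rw [hW, ← Complex.ofReal_mul,
        rpow_mul_rpow_of_one_div_eq (norm_nonneg _) hr0 hrtop hP0 hQ0 hr])
    rw [hU]
    exact hmul U W (hS _ E Ψ V hΨ hV W hI)
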